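/- **Setting.** Let $d,m\ge 1$ be integers, $0<\beta\le 1$, $\alpha\ge 0$ with $\alpha\beta\le d$, $\boldsymbol\gamma=(\gamma_1,\dots,\gamma_m)$ and $(C_{\gamma_1},\dots,C_{\gamma_m})$ vectors with positive entries, and $C_\alpha,C_\beta,c_\mu,r_\mu>0$, $0<\mu_-<\mu_+$ constants. For a distribution $G$ of a pair $(X,Y)$ with values in $\mathbb R^d\times\{0,1\}$ let $G_X$ be the law of $X$, and let $\eta_G(x)=G(Y=1\mid X=x)$ for $x\in\operatorname{supp}(G_X)$ and $\eta_G(x)=\frac12$ otherwise. Let $\Pi=\Pi(\alpha,\beta,\boldsymbol\gamma,\mu)$ be the set of all tuples $(P_1,\dots,P_m,Q)$ of such distributions for which, for suitable versions of the regression functions, * for every $i$ and every $x\in\operatorname{supp}(P_{i,X})\cup\operatorname{supp}(Q_X)$: $(\eta_{P_i}(x)-\frac12)(\eta_Q(x)-\frac12)\ge 0$ and $|\eta_{P_i}(x)-\frac12|\ge C_{\gamma_i}|\eta_Q(x)-\frac12|^{\gamma_i}$; * $Q_X(|\eta_Q(X)-\frac12|<t)\le C_\alpha t^\alpha$ for all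 $t>0$; * $|\eta_Q(x_1)-\eta_Q(x_2)|\le C_\beta\|x_1-x_2\|^\beta$ for all $x_1,x_2\in\operatorname{supp}(Q_X)$; * for every $i$, $P_{i,X}$ and $Q_X$ are absolutely continuous with respect to Lebesgue measure $\lambda$ and have the same support $\Omega$, their densities lie strictly between $\mu_-$ and $\mu_+$ on $\Omega$ (almost everywhere), and $\lambda(\Omega\cap B(x,r))\ge c_\mu\lambda(B(x,r))$ for all $x\in\Omega$ and $0<r\le r_\mu$. We observe independent samples of sizes $n_{P_1},\dots,n_{P_m},n_Q\ge 0$ from $P_1,\dots,P_m,Q$, and put $n=n_Q+\sum_{i=1}^m n_{P_i}$. The risk of $f:\mathbb R^d\to\{0,1\}$ is $R_Q(f)=Q(f(X)\ne Y)$; its excess risk is $\mathcal E_Q(f)=R_Q(f)-R_Q(f_Q^*)$, where $f_Q^*(x)=0$ if $\eta_Q(x)\le\frac12$ and $f_Q^*(x)=1$ otherwise. **The classifier $\hat f_a$.** Fix $x$. For $1\le k\le n$ take the $k$ nearest neighbours of $x$ among all $n$ pooled covariates. For each population $g\in\{Q,P_1,\dots,P_m\}$ let $k_g^{(k)}$ be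 the number of these neighbours that come from $g$, and let $\hat\eta_g^{(k)}$ be the average of their labels ($\frac12$ if $k_g^{(k)}=0$). Define the positive and negative signal-to-noise indices $$\hat r_+^{(k)}=\sum_g \mathbf 1\{\hat\eta_g^{(k)}\ge\tfrac12\}\,k_g^{(k)}\bigl(\hat\eta_g^{(k)}-\tfrac12\bigr)^2,\qquad \hat r_-^{(k)}=\sum_g \mathbf 1\{\hat\eta_g^{(k)}<\tfrac12\}\,k_g^{(k)}\bigl(\hat\eta_g^{(k)}-\tfrac12\bigr)^2,$$ and $\hat r^{(k)}=\max\{\hat r_+^{(k)},\hat r_-^{(k)}\}$, $\hat f^{(k)}(x)=\mathbf 1\{\hat r_+^{(k)}\ge\hat r_-^{(k)}\}$. Then $\hat f_a(x)=\hat f^{(k)}(x)$ for the smallest $k$ with $\hat r^{(k)}>(d+3)\log n$, if there is one; otherwise $\hat f_a(x)=\hat f^{(k_m)}(x)$ with $k_m\in\operatorname{argmax}_k\hat r^{(k)}$. Ties between distances and between maximizers are broken in an arbitrary measurable way. **Theorem.** There is a constant $C>0$, depending only on $d$, $m$ and the constants that define $\Pi$ and not on the sample sizes, such that for all sample sizes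 with $n\ge 2$ $$\sup_{(P_1,\dots,P_m,Q)\in\Pi}\mathbb E\,\mathcal E_Q(\hat f_a)\le C\left(\frac{n_Q}{\log n}+\sum_{i=1}^m\Bigl(\frac{n_{P_i}}{\log n}\Bigr)^{\frac{2\beta+d}{2\gamma_i\beta+d}}\right)^{-\frac{\beta(1+\alpha)}{2\beta+d}}.$$ -/

import Mathlib

open MeasureTheory

noncomputable section

namespace PosteriorDrift

/-- The feature space `ℝ^d` with the Euclidean norm. -/
abbrev Feature (d : ℕ) : Type := EuclideanSpace ℝ (Fin d)

/-! ### The posterior drift model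

A joint distribution of `(X, Y)` is a measure on `Feature d × Bool`; the label `1` is `true` and the
label `0` is `false`. -/

/-- The marginal distribution of the covariate `X`. -/
def marginal {d : ℕ} (P : Measure (Feature d × Bool)) : Measure (Feature d) := P.map Prod.fst

/-- `η` is (a version of) the regression function of `P`: `η x = P(Y = 1 | X = x)` on the support of
the marginal of `X`, and `η x = 1/2` off the support. -/
structure IsRegressionFunction {d : ℕ} (P : Measure (Feature d × Bool)) (η : Feature d → ℝ) :
    Prop where
  measurable : Measurable η
  mem_Icc : ∀ x, η x ∈ Set.Icc (0 : ℝ) 1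
  condProb : ∀ A : Set (Feature d), MeasurableSet A →
    P (A ×ˢ {true}) = ∫⁻ x in A, ENNReal.ofReal (η x) ∂(marginal P)
  off_support : ∀ x, x ∉ (marginal P).support → η x = 1 / 2

/-- The relative signal exponent condition of the pair `(P, Q)`, whose regression functions are
`ηP` and `ηQ`, with exponent `γ` and constant `Cγ`. -/
def RelativeSignalExponent {d : ℕ} (P Q : Measure (Feature d × Bool)) (ηP ηQ : Feature d → ℝ)
    (γ Cγ : ℝ) : Prop :=
  ∀ x ∈ (marginal P).support ∪ (marginal Q).support,
    0 ≤ (ηP x - 1 / 2) * (ηQ x - 1 / 2) ∧ Cγ * |ηQ x - 1 / 2| ^ γ ≤ |ηP x - 1 / 2|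

/-- The margin assumption. -/
def MarginAssumption {d : ℕ} (Q : Measure (Feature d × Bool)) (ηQ : Feature d → ℝ)
    (α Cα : ℝ) : Prop :=
  ∀ t : ℝ, 0 < t → marginal Q {x | |ηQ x - 1 / 2| < t} ≤ ENNReal.ofReal (Cα * t ^ α)

/-- `(β, Cβ)`-Hölder smoothness of `g` on the set `S`. -/
def HolderOn {d : ℕ} (g : Feature d → ℝ) (β Cβ : ℝ) (S : Set (Feature d)) : Prop :=
  ∀ x₁ ∈ S, ∀ x₂ ∈ S, |g x₁ - g x₂| ≤ Cβ * ‖x₁ - x₂‖ ^ β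

/-- The density of `ν` with respect to Lebesgue measure exists and lies strictly between `μlo` and
`μhi` on the support of `ν` (a density is defined up to null sets only). -/
def DensityBounds {d : ℕ} (ν : Measure (Feature d)) (μlo μhi : ℝ) : Prop :=
  ν ≪ volume ∧ ∀ᵐ x ∂(volume.restrict ν.support),
    ENNReal.ofReal μlo < ν.rnDeriv volume x ∧ ν.rnDeriv volume x < ENNReal.ofReal μhi

/-- Common support and strong density assumption for a pair of marginal distributions. -/
def StrongDensity {d : ℕ} (νP νQ : Measure (Feature d)) (μlo μhi cμ rμ : ℝ) : Prop :=
  νP.support = νQ.support ∧ DensityBounds νP μlo μhi ∧ DensityBounds νQ μlo μhi ∧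
    ∀ x ∈ νQ.support, ∀ r : ℝ, 0 < r → r ≤ rμ →
      ENNReal.ofReal cμ * volume (Metric.closedBall x r) ≤
        volume (νQ.support ∩ Metric.closedBall x r)

/-- The multi-source posterior drift class: `(P 1, …, P m, Q)`, with regression functions
`ηP 1, …, ηP m, ηQ`, belongs to `Π(α, Cα, β, Cβ, γ, Cγ, μ, cμ, rμ)`. -/
structure MemClass {d m : ℕ} (α Cα β Cβ : ℝ) (γ Cγ : Fin m → ℝ) (μlo μhi cμ rμ : ℝ)
    (P : Fin m → Measure (Feature d × Bool)) (Q : Measure (Feature d × Bool))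
    (ηP : Fin m → Feature d → ℝ) (ηQ : Feature d → ℝ) : Prop where
  probP : ∀ i, IsProbabilityMeasure (P i)
  probQ : IsProbabilityMeasure Q
  regP : ∀ i, IsRegressionFunction (P i) (ηP i)
  regQ : IsRegressionFunction Q ηQ
  signal : ∀ i, RelativeSignalExponent (P i) Q (ηP i) ηQ (γ i) (Cγ i)
  margin : MarginAssumption Q ηQ α Cα
  smooth : HolderOn ηQ β Cβ (marginal Q).support
  density : ∀ i, StrongDensity (marginal (P i)) (marginal Q) μlo μhi cμ rμ

/-! ### Risk -/

/-- The misclassification error `R_Q(f) = Q(f(X) ≠ Y)`. -/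
def risk {d : ℕ} (Q : Measure (Feature d × Bool)) (f : Feature d → Bool) : ℝ :=
  Q.real {z | f z.1 ≠ z.2}

open Classical in
/-- The Bayes classifier: label `0` if `η x ≤ 1/2` and label `1` otherwise. -/
def bayes {d : ℕ} (η : Feature d → ℝ) : Feature d → Bool :=
  fun x => if η x ≤ 1 / 2 then false else true

/-- The excess risk of `f` under the distribution `Q` with regression function `ηQ`. -/
def excessRisk {d : ℕ} (Q : Measure (Feature d × Bool)) (ηQ : Feature d → ℝ)
    (f : Feature d → Bool) : ℝ :=
  risk Q f - risk Q (bayes ηQ)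

/-! ### The data

The populations are indexed by `Option (Fin m)`: `none` is the target and `some i` is the `i`-th
source. -/

/-- The size of the sample from each population. -/
abbrev sampleSize {m : ℕ} (nQ : ℕ) (nP : Fin m → ℕ) (g : Option (Fin m)) : ℕ := g.elim nQ nP

/-- The indices of the observations in the pooled sample. -/
abbrev SampleIdx {m : ℕ} (nQ : ℕ) (nP : Fin m → ℕ) : Type :=
  Σ g : Option (Fin m), Fin (sampleSize nQ nP g)

/-- The total sample size `n`. -/
abbrev totalSize {m : ℕ} (nQ : ℕ) (nP : Fin m → ℕ) : ℕ := nQ + ∑ i, nP i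

/-- A realization of all the observations. -/
abbrev Data (d : ℕ) {m : ℕ} (nQ : ℕ) (nP : Fin m → ℕ) : Type :=
  SampleIdx nQ nP → Feature d × Bool

/-- The joint law of all the observations: they are independent, each observation from the `i`-th
source has law `P i`, and each observation from the target has law `Q`. -/
def dataLaw {d m : ℕ} (P : Fin m → Measure (Feature d × Bool)) (Q : Measure (Feature d × Bool))
    (nQ : ℕ) (nP : Fin m → ℕ) : Measure (Data d nQ nP) :=
  Measure.pi fun s : SampleIdx nQ nP => s.1.elim Q P

/-! ### The adaptive classifier -/

section Algorithm

variable {m nQ : ℕ} {nP : Fin m → ℕ}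

/-- An enumeration of the pooled sample: position `j` holds the `(j + 1)`-st nearest neighbour. -/
abbrev Ordering (nQ : ℕ) (nP : Fin m → ℕ) : Type :=
  Fin (totalSize nQ nP) ≃ SampleIdx nQ nP

/-- `σ` lists the pooled covariates in order of nondecreasing distance to `x`. -/
def IsNeighbourOrdering {d : ℕ} (Z : Data d nQ nP) (x : Feature d) (σ : Ordering nQ nP) : Prop :=
  Monotone fun j => ‖(Z (σ j)).1 - x‖

/-- The positions, among the `k` nearest neighbours, of the observations from population `g`. -/
def neighbours (σ : Ordering nQ nP) (k : ℕ) (g : Option (Fin m)) :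
    Finset (Fin (totalSize nQ nP)) :=
  Finset.univ.filter fun j => (j : ℕ) < k ∧ (σ j).1 = g

/-- The number of observations from population `g` among the `k` nearest neighbours. -/
def count (σ : Ordering nQ nP) (k : ℕ) (g : Option (Fin m)) : ℕ := (neighbours σ k g).card

/-- The nearest neighbour estimate in population `g` at step `k`; `y` is the vector of labels. -/
def etaHat (σ : Ordering nQ nP) (y : SampleIdx nQ nP → Bool) (k : ℕ) (g : Option (Fin m)) : ℝ :=
  if count σ k g = 0 then 1 / 2
  else (∑ j ∈ neighbours σ k g, if y (σ j) then (1 : ℝ) else 0) / (count σ k g : ℝ)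

open Classical in
/-- The positive signal-to-noise index. -/
def rPos (σ : Ordering nQ nP) (y : SampleIdx nQ nP → Bool) (k : ℕ) : ℝ :=
  ∑ g : Option (Fin m),
    if 1 / 2 ≤ etaHat σ y k g then (count σ k g : ℝ) * (etaHat σ y k g - 1 / 2) ^ 2 else 0

open Classical in
/-- The negative signal-to-noise index. -/
def rNeg (σ : Ordering nQ nP) (y : SampleIdx nQ nP → Bool) (k : ℕ) : ℝ :=
  ∑ g : Option (Fin m),
    if etaHat σ y k g < 1 / 2 then (count σ k g : ℝ) * (etaHat σ y k g - 1 / 2) ^ 2 else 0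

/-- The signal-to-noise ratio index. -/
def rHat (σ : Ordering nQ nP) (y : SampleIdx nQ nP → Bool) (k : ℕ) : ℝ :=
  max (rPos σ y k) (rNeg σ y k)

open Classical in
/-- The intermediate classifier at step `k`. -/
def stepClassifier (σ : Ordering nQ nP) (y : SampleIdx nQ nP → Bool) (k : ℕ) : Bool :=
  if rNeg σ y k ≤ rPos σ y k then true else false

/-- The stopping threshold `(d + 3) log n`. -/
def threshold (d n : ℕ) : ℝ := ((d : ℝ) + 3) * Real.log n

/-- `b` is an output of the algorithm when the neighbours are listed by `σ` and the labels are `y`: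
either the algorithm stops at step `k`, the first one with an index above the threshold, or no index
exceeds the threshold and `k` is some maximizer of the index; and `b` is the intermediate classifier
at step `k`. -/
def IsOutput (d : ℕ) (σ : Ordering nQ nP) (y : SampleIdx nQ nP → Bool) (b : Bool) : Prop :=
  ∃ k ∈ Finset.Icc 1 (totalSize nQ nP),
    ((threshold d (totalSize nQ nP) < rHat σ y k ∧
        ∀ j ∈ Finset.Ico 1 k, rHat σ y j ≤ threshold d (totalSize nQ nP)) ∨
      ((∀ j ∈ Finset.Icc 1 (totalSize nQ nP), rHat σ y j ≤ threshold d (totalSize nQ nP)) ∧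
        ∀ j ∈ Finset.Icc 1 (totalSize nQ nP), rHat σ y j ≤ rHat σ y k)) ∧
    b = stepClassifier σ y k

/-- `f` is the adaptive classifier: for all data `Z` and every point `x`, the label `f Z x` is the
output of the algorithm. Ties between distances, and between maximizers of the index, may be broken
in any way for which `f` is measurable in data and point. -/
structure IsAdaptiveClassifier {d : ℕ} (f : Data d nQ nP → Feature d → Bool) : Prop where
  measurable : Measurable (Function.uncurry f)
  output : ∀ Z x, ∃ σ : Ordering nQ nP,
    IsNeighbourOrdering Z x σ ∧ IsOutput d σ (fun s => (Z s).2) (f Z x)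

/-- The pooled sample can be ordered by distance. -/
theorem exists_ordering {d : ℕ} (Z : Data d nQ nP) (x : Feature d) :
    ∃ σ : Ordering nQ nP, IsNeighbourOrdering Z x σ := by
  have hc : Fintype.card (SampleIdx nQ nP) = totalSize nQ nP := by
    simp [Fintype.card_sigma, Fintype.sum_option, sampleSize, totalSize]
  let e : Ordering nQ nP := (Fintype.equivFinOfCardEq hc).symm
  refine ⟨(Tuple.sort fun j => ‖(Z (e j)).1 - x‖).trans e, ?_⟩
  exact Tuple.monotone_sort fun j => ‖(Z (e j)).1 - x‖

/-- The algorithm always has an output. -/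
theorem exists_output (d : ℕ) (h : 1 ≤ totalSize nQ nP) (σ : Ordering nQ nP)
    (y : SampleIdx nQ nP → Bool) : ∃ b, IsOutput d σ y b := by
  classical
  by_cases hs : ∃ k, k ∈ Finset.Icc 1 (totalSize nQ nP) ∧
      threshold d (totalSize nQ nP) < rHat σ y k
  · have h1 := Nat.find_spec hs
    refine ⟨_, Nat.find hs, h1.1, Or.inl ⟨h1.2, fun j hj => ?_⟩, rfl⟩
    by_contra hlt
    rw [Finset.mem_Ico] at hj
    have h2 := (Finset.mem_Icc.1 h1.1).2
    exact Nat.find_min hs hj.2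
      ⟨Finset.mem_Icc.2 ⟨hj.1, by omega⟩, not_le.1 hlt⟩
  · push Not at hs
    obtain ⟨k, hk, hmax⟩ := (Finset.Icc 1 (totalSize nQ nP)).exists_max_image (rHat σ y)
      ⟨1, Finset.mem_Icc.2 ⟨le_rfl, h⟩⟩
    exact ⟨_, k, hk, Or.inr ⟨hs, hmax⟩, rfl⟩

/-- The adaptive classifier exists, so that a statement about all adaptive classifiers is not
vacuous. -/
theorem exists_isAdaptiveClassifier (d : ℕ) (h : 1 ≤ totalSize nQ nP) :
    ∃ f : Data d nQ nP → Feature d → Bool, IsAdaptiveClassifier f := by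
  classical
  let V : Ordering nQ nP → Set (Data d nQ nP × Feature d) := fun σ =>
    {p | IsNeighbourOrdering p.1 p.2 σ ∧ IsOutput d σ (fun s => (p.1 s).2) true}
  have hV : ∀ σ, MeasurableSet (V σ) := by
    intro σ
    change MeasurableSet ({p : Data d nQ nP × Feature d | IsNeighbourOrdering p.1 p.2 σ} ∩
      {p | IsOutput d σ (fun s => (p.1 s).2) true})
    refine MeasurableSet.inter ?_ ?_
    · have : {p : Data d nQ nP × Feature d | IsNeighbourOrdering p.1 p.2 σ} =
          ⋂ i, ⋂ j, {p | i ≤ j → ‖(p.1 (σ i)).1 - p.2‖ ≤ ‖(p.1 (σ j)).1 - p.2‖} := by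
        ext p; simp [IsNeighbourOrdering, Monotone]
      rw [this]
      refine MeasurableSet.iInter fun i => MeasurableSet.iInter fun j => ?_
      by_cases hij : i ≤ j
      · simp only [hij, true_imp_iff]
        exact measurableSet_le (by fun_prop) (by fun_prop)
      · simp [hij]
    · have hm : Measurable fun p : Data d nQ nP × Feature d =>
          (fun s => (p.1 s).2 : SampleIdx nQ nP → Bool) := by fun_prop
      exact hm (MeasurableSet.of_discrete (s := {y | IsOutput d σ y true}))
  refine ⟨fun Z x => decide ((Z, x) ∈ ⋃ σ, V σ), ?_, fun Z x => ?_⟩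
  · refine measurable_to_bool ?_
    have : (Function.uncurry fun (Z : Data d nQ nP) (x : Feature d) =>
        decide ((Z, x) ∈ ⋃ σ, V σ)) ⁻¹' {true} = ⋃ σ, V σ := by
      ext p; simp [Function.uncurry]
    rw [this]
    exact MeasurableSet.iUnion hV
  · by_cases hx : (Z, x) ∈ ⋃ σ, V σ
    · obtain ⟨σ, hσ⟩ := Set.mem_iUnion.1 hx
      exact ⟨σ, hσ.1, by simpa only [hx, decide_true] using hσ.2⟩
    · obtain ⟨σ, hσ⟩ := exists_ordering Z x
      obtain ⟨b, hb⟩ := exists_output d h σ fun s => (Z s).2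
      refine ⟨σ, hσ, ?_⟩
      cases b with
      | true => exact absurd (Set.mem_iUnion.2 ⟨σ, (⟨hσ, hb⟩ : (Z, x) ∈ V σ)⟩) hx
      | false => simpa only [hx, decide_false] using hb

end Algorithm

end PosteriorDrift

end

open PosteriorDrift

/-! Fix `x` in the support of `Q_X`, with `Δ = |η_Q(x) - 1/2| > 0` and Bayes label `b`, and let `r =
c₁ Δ^(1/β)` with `c₁` small. By Hölder continuity `η_Q` stays on its side of `1/2`, at distance at
least `Δ/2`, throughout the ball of radius `r`. The signal condition transfers this to each source,
with bias at least `C_γ (Δ/2)^γ`. Hence near `x` all populations favour `b`, and two events force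
the output `b`.

No false alarm: in every ball around `x` through a sample point within distance `r`, the index
against `b` is at most `T = (d+3) log n`. Given the covariates, Hoeffding bounds the exponential
moment of each population's share of the index. Independence multiplies these moments, and Markov
together with a union over at most `n` balls leaves `O(n e^(-T)) = O(n^(-2))`
(`measure_exists_signalIndex_gt_le`).

Detection: in the ball of radius `r` the index for `b` exceeds `T`. A Chernoff bound gives this as
soon as one population has `n_g r^d v_g^2` above a multiple of `log n`, where `v_g` is its bias
(`measure_sum_excessDir_le`, `signalIndex_gt_of_sum_excessDir_gt`).

On both events the procedure stops no later than at that ball, and the index that triggered the stop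
can only be the one for `b` (`IsOutput.eq_of_signalIndex`).

With `S` the effective sample size, pigeonhole on the terms of `S` provides such a population
whenever `Δ ≥ τ = A S^(-β/(2β+d))` (`exists_signal_ge`). Points with `Δ < τ` cost at most `2τ · C_α
τ^α` by the margin assumption. The others cost `O(n^(-2))`, which is within the rate because `S`
grows at most polynomially in `n` and `αβ ≤ d` (`inv_sq_le_effSize_rpow`). -/

open ProbabilityTheory
open scoped ENNReal

noncomputable section

namespace PosteriorDrift

/-! ### Concentration of the signal-to-noise index of a fixed set of observations -/

/-- The signed deviation of a label `y` from `1/2`, in the direction of the label `b`. -/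
def dir (b y : Bool) : ℝ := if y = b then 1 / 2 else -(1 / 2)

lemma dir_mem_Icc (b y : Bool) : dir b y ∈ Set.Icc (-(1 / 2) : ℝ) (1 / 2) := by
  unfold dir; split_ifs <;> constructor <;> norm_num

/-- The contribution of the population `g` to the signal-to-noise index of the finset `S`. -/
def blockIndex {ι G : Type*} [DecidableEq G] (pop : ι → G) (w : ι → ℝ) (S : Finset ι) (g : G) : ℝ :=
  (max (∑ s ∈ S with pop s = g, w s) 0) ^ 2 / ((S.filter (pop · = g)).card : ℝ)

/-- The signal-to-noise index of the observations in `S`, with signed deviations `w`. -/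
def signalIndex {ι G : Type*} [Fintype G] [DecidableEq G] (pop : ι → G) (w : ι → ℝ)
    (S : Finset ι) : ℝ := ∑ g, blockIndex pop w S g

lemma blockIndex_nonneg {ι G : Type*} [DecidableEq G] (pop : ι → G) (w : ι → ℝ) (S : Finset ι)
    (g : G) : 0 ≤ blockIndex pop w S g := by
  unfold blockIndex; positivity

/-- A bound for the exponential moment of a variable with tail `exp (-2 t)`. -/
def expMomentBound : ℝ≥0∞ := ∑' j : ℕ, ENNReal.ofReal (Real.exp (1 - j))

lemma expMomentBound_ne_top : expMomentBound ≠ ⊤ := by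
  have h : Summable fun j : ℕ => Real.exp (1 - j) := by
    have : (fun j : ℕ => Real.exp (1 - j)) = fun j : ℕ => Real.exp 1 * (Real.exp (-1)) ^ j := by
      funext j
      rw [← Real.exp_nat_mul, ← Real.exp_add]
      congr 1; ring
    rw [this]
    exact (summable_geometric_of_lt_one (Real.exp_pos _).le (by simp)).mul_left _
  exact h.tsum_ofReal_ne_top

/-- Slicing at integer levels: where `⌊Z⌋ = j` the exponential is at most `e^(j+1)`, and the tail
`e^(-2j)` leaves the geometric series of `e^(1-j)`. -/
lemma lintegral_exp_le_of_tail {Ω : Type*} [MeasurableSpace Ω] {μ : Measure Ω}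
    [IsProbabilityMeasure μ] {Z : Ω → ℝ} (hZ : Measurable Z) (h0 : ∀ ω, 0 ≤ Z ω)
    (h : ∀ t : ℝ, 0 < t → μ {ω | t ≤ Z ω} ≤ ENNReal.ofReal (Real.exp (-2 * t))) :
    ∫⁻ ω, ENNReal.ofReal (Real.exp (Z ω)) ∂μ ≤ expMomentBound := by
  have hmeas : ∀ j : ℕ, MeasurableSet {ω | (j : ℝ) ≤ Z ω} := fun j =>
    measurableSet_le measurable_const hZ
  calc ∫⁻ ω, ENNReal.ofReal (Real.exp (Z ω)) ∂μ
      ≤ ∫⁻ ω, ∑' j : ℕ, ({ω | (j : ℝ) ≤ Z ω}.indicator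
          (fun _ => ENNReal.ofReal (Real.exp (j + 1))) ω) ∂μ := by
        refine lintegral_mono fun ω => ?_
        refine le_trans ?_ (ENNReal.le_tsum ⌊Z ω⌋₊)
        rw [Set.indicator_of_mem (by exact Nat.floor_le (h0 ω))]
        exact ENNReal.ofReal_le_ofReal (Real.exp_le_exp.2 (Nat.lt_floor_add_one _).le)
    _ = ∑' j : ℕ, ENNReal.ofReal (Real.exp (j + 1)) * μ {ω | (j : ℝ) ≤ Z ω} := by
        rw [lintegral_tsum fun j => (measurable_const.indicator (hmeas j)).aemeasurable]
        exact tsum_congr fun j => by rw [lintegral_indicator_const (hmeas j)]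
    _ ≤ expMomentBound := by
        refine ENNReal.tsum_le_tsum fun j => ?_
        have hj : μ {ω | (j : ℝ) ≤ Z ω} ≤ ENNReal.ofReal (Real.exp (-2 * j)) := by
          rcases Nat.eq_zero_or_pos j with rfl | hj
          · simpa using prob_le_one
          · exact h j (by exact_mod_cast hj)
        calc _ ≤ ENNReal.ofReal (Real.exp (j + 1)) * ENNReal.ofReal (Real.exp (-2 * j)) := by
              gcongr
          _ = _ := by
              rw [← ENNReal.ofReal_mul (Real.exp_pos _).le, ← Real.exp_add]
              congr 2; ring

/-- Hoeffding's inequality: the summands lie in an interval of length 1 and have nonpositive mean,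
so centring them only raises the sum. -/
lemma measure_sum_dir_ge_le {ι Ω : Type*} [MeasurableSpace Ω] {μ : Measure Ω}
    [IsProbabilityMeasure μ] {Y : ι → Ω → Bool} (hY : ∀ s, Measurable (Y s)) (hind : iIndepFun Y μ)
    (b : Bool) (S : Finset ι) (hS : ∀ s ∈ S, μ.real {ω | Y s ω = b} ≤ 1 / 2) {a : ℝ} (ha : 0 ≤ a) :
    μ.real {ω | a ≤ ∑ s ∈ S, dir b (Y s ω)} ≤ Real.exp (-2 * a ^ 2 / S.card) := by
  set X : ι → Ω → ℝ := fun s ω => dir b (Y s ω) with hX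
  have hXm : ∀ s, Measurable (X s) := fun s => (Measurable.of_discrete (f := dir b)).comp (hY s)
  have hmean : ∀ s ∈ S, μ[X s] ≤ 0 := by
    intro s hs
    have h1 : X s = fun ω => {ω | Y s ω = b}.indicator (fun _ => (1 : ℝ)) ω - 1 / 2 := by
      funext ω
      by_cases h : Y s ω = b
      · simp [hX, dir, h]; norm_num
      · simp [hX, dir, h]
    have hm : MeasurableSet {ω | Y s ω = b} := hY s (measurableSet_singleton b)
    rw [h1, integral_sub ((integrable_const _).indicator hm) (integrable_const _),
      integral_indicator_const _ hm]
    have := hS s hs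
    simp; simpa using this
  have hind' : iIndepFun (fun s ω => X s ω - μ[X s]) μ :=
    hind.comp (fun s y => dir b y - ∫ ω, X s ω ∂μ) fun s => Measurable.of_discrete
  have hsub : ∀ s ∈ S, HasSubgaussianMGF (fun ω => X s ω - μ[X s])
      ((‖(1 / 2 : ℝ) - -(1 / 2)‖₊ / 2) ^ 2) μ := fun s _ =>
    hasSubgaussianMGF_of_mem_Icc (hXm s).aemeasurable
      (Filter.Eventually.of_forall fun ω => dir_mem_Icc b _)
  have key := HasSubgaussianMGF.measure_sum_ge_le_of_iIndepFun hind' hsub ha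
  refine (measureReal_mono fun ω hω => ?_).trans (key.trans (le_of_eq ?_))
  · have hω' : a ≤ ∑ s ∈ S, X s ω := hω
    simp only [Set.mem_ofPred_eq, Finset.sum_sub_distrib]
    have := Finset.sum_nonpos hmean
    linarith
  · congr 1
    have : ‖(1 / 2 : ℝ) - -(1 / 2)‖ = 1 := by norm_num
    push_cast
    rw [Finset.sum_const, this, nsmul_eq_mul]
    -- For empty `S` both quotients are `0` by convention and the bound is the trivial `1`.
    by_cases h : (S.card : ℝ) = 0
    · simp [h]
    · field_simp

/-- An index of at least `t > 0` over `N` labels means a sum of at least `√(tN)`, for which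
Hoeffding gives `e^(-2t)` whatever `N` is. The positive part makes the event one-sided, so only an
upper bound on the means is needed. -/
lemma lintegral_exp_blockIndex_le {ι G Ω : Type*} [DecidableEq G] [MeasurableSpace Ω]
    {μ : Measure Ω} [IsProbabilityMeasure μ] {Y : ι → Ω → Bool} (hY : ∀ s, Measurable (Y s))
    (hind : iIndepFun Y μ) (pop : ι → G) (b : Bool) (S : Finset ι)
    (hS : ∀ s ∈ S, μ.real {ω | Y s ω = b} ≤ 1 / 2) (g : G) :
    ∫⁻ ω, ENNReal.ofReal (Real.exp (blockIndex pop (fun s => dir b (Y s ω)) S g)) ∂μ ≤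
      expMomentBound := by
  have hm : Measurable fun ω => blockIndex pop (fun s => dir b (Y s ω)) S g := by
    unfold blockIndex
    have : ∀ s, Measurable fun ω => dir b (Y s ω) := fun s =>
      (Measurable.of_discrete (f := dir b)).comp (hY s)
    fun_prop
  refine lintegral_exp_le_of_tail hm (fun ω => blockIndex_nonneg _ _ _ _) fun t ht => ?_
  rw [← ofReal_measureReal]
  refine ENNReal.ofReal_le_ofReal ?_
  set S' := S.filter (pop · = g) with hS'
  rcases S'.eq_empty_or_nonempty with he | hne
  · have : {ω | t ≤ blockIndex pop (fun s => dir b (Y s ω)) S g} = ∅ := by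
      ext ω
      simp only [blockIndex, ← hS', he]
      simpa using ht
    rw [this]
    simpa using (Real.exp_pos _).le
  have hc : (0 : ℝ) < S'.card := by exact_mod_cast hne.card_pos
  refine (measureReal_mono fun ω hω => ?_).trans ((measure_sum_dir_ge_le hY hind b S'
    (fun s hs => hS s (Finset.mem_filter.1 hs).1) (Real.sqrt_nonneg (t * S'.card))).trans
    (le_of_eq ?_))
  · simp only [Set.mem_ofPred_eq, blockIndex] at hω ⊢
    rw [le_div_iff₀ hc] at hω
    have h1 := Real.sqrt_le_sqrt hω
    rw [Real.sqrt_sq (le_max_right _ _)] at h1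
    rcases le_max_iff.1 h1 with h2 | h2
    · exact h2
    · exact absurd h2 (not_le.2 (Real.sqrt_pos.2 (by positivity)))
  · rw [Real.sq_sqrt (by positivity)]
    congr 1; field_simp

lemma lintegral_mul_of_dependsOn_disjoint {ι Ω : Type*} [Fintype ι] [DecidableEq ι]
    [MeasurableSpace Ω] {μ : Measure Ω} {Y : ι → Ω → Bool}
    (hY : ∀ s, Measurable (Y s)) (hind : iIndepFun Y μ) {S T : Finset ι} (hST : Disjoint S T)
    {f g : (ι → Bool) → ℝ≥0∞} (hf : DependsOn f (S : Set ι)) (hg : DependsOn g (T : Set ι)) :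
    ∫⁻ ω, f (fun s => Y s ω) * g (fun s => Y s ω) ∂μ =
      (∫⁻ ω, f (fun s => Y s ω) ∂μ) * ∫⁻ ω, g (fun s => Y s ω) ∂μ := by
  -- The filler value outside `A` is immaterial, since the functions involved only read the
  -- coordinates in `A`.
  let ext : ∀ A : Finset ι, (A → Bool) → ι → Bool := fun A z s =>
    if h : s ∈ A then z ⟨s, h⟩ else false
  have h1 : (fun ω => f (fun s => Y s ω)) =
      (fun z => f (ext S z)) ∘ fun ω (i : S) => Y i ω := by
    funext ω
    exact hf fun s hs => by simp [ext, Finset.mem_coe.1 hs]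
  have h2 : (fun ω => g (fun s => Y s ω)) =
      (fun z => g (ext T z)) ∘ fun ω (i : T) => Y i ω := by
    funext ω
    exact hg fun s hs => by simp [ext, Finset.mem_coe.1 hs]
  have hYv : Measurable fun ω s => Y s ω := measurable_pi_lambda _ hY
  refine lintegral_mul_eq_lintegral_mul_lintegral_of_indepFun
    ((Measurable.of_discrete (f := f)).comp hYv) ((Measurable.of_discrete (f := g)).comp hYv) ?_
  rw [h1, h2]
  exact (hind.indepFun_finset S T hST hY).comp Measurable.of_discrete Measurable.of_discrete

lemma lintegral_prod_of_dependsOn_block {ι G Ω : Type*} [Fintype ι] [DecidableEq ι] [DecidableEq G]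
    [MeasurableSpace Ω] {μ : Measure Ω} {Y : ι → Ω → Bool}
    (hY : ∀ s, Measurable (Y s)) (hind : iIndepFun Y μ) (pop : ι → G)
    {f : G → (ι → Bool) → ℝ≥0∞} (hf : ∀ g, DependsOn (f g) {s | pop s = g}) (A : Finset G) :
    ∫⁻ ω, ∏ g ∈ A, f g (fun s => Y s ω) ∂μ = ∏ g ∈ A, ∫⁻ ω, f g (fun s => Y s ω) ∂μ := by
  have : IsProbabilityMeasure μ := hind.isProbabilityMeasure
  induction A using Finset.induction_on with
  | empty => simp
  | insert a A ha ih =>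
    simp only [Finset.prod_insert ha]
    rw [← ih]
    refine lintegral_mul_of_dependsOn_disjoint hY hind (f := f a)
      (g := fun y => ∏ g ∈ A, f g y) (S := Finset.univ.filter (pop · = a))
      (T := Finset.univ.filter (pop · ∈ A)) ?_ ?_ ?_
    · rw [Finset.disjoint_left]
      intro s hs hs'
      simp only [Finset.mem_filter, Finset.mem_univ, true_and] at hs hs'
      exact ha (hs ▸ hs')
    · simpa using hf a
    · intro y y' h
      refine Finset.prod_congr rfl fun g hg => hf g fun s hs => h s ?_
      have hs' : pop s = g := hs
      simpa [hs'] using hg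

/-- If each label in `S` is more likely to differ from `b` than to agree with it, then a large
signal-to-noise index in the direction of `b` is unlikely. -/
lemma measure_signalIndex_gt_le {ι G Ω : Type*} [Fintype ι] [DecidableEq ι] [Fintype G]
    [DecidableEq G] [MeasurableSpace Ω] {μ : Measure Ω} [IsProbabilityMeasure μ]
    {Y : ι → Ω → Bool} (hY : ∀ s, Measurable (Y s)) (hind : iIndepFun Y μ) (pop : ι → G) (b : Bool)
    (S : Finset ι) (hS : ∀ s ∈ S, μ.real {ω | Y s ω = b} ≤ 1 / 2) (T : ℝ) :
    μ {ω | T < signalIndex pop (fun s => dir b (Y s ω)) S} ≤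
      expMomentBound ^ Fintype.card G * ENNReal.ofReal (Real.exp (-T)) := by
  -- The exponential of the index is a product over populations, whose labels form disjoint
  -- independent groups.
  have hprod : ∫⁻ ω, ENNReal.ofReal (Real.exp (signalIndex pop (fun s => dir b (Y s ω)) S)) ∂μ ≤
      expMomentBound ^ Fintype.card G := by
    have h1 : ∀ ω, ENNReal.ofReal (Real.exp (signalIndex pop (fun s => dir b (Y s ω)) S)) =
        ∏ g, ENNReal.ofReal (Real.exp (blockIndex pop (fun s => dir b (Y s ω)) S g)) := by
      intro ω
      rw [signalIndex, Real.exp_sum, ENNReal.ofReal_prod_of_nonneg fun _ _ => (Real.exp_pos _).le]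
    simp only [h1]
    rw [lintegral_prod_of_dependsOn_block hY hind pop
      (f := fun g y => ENNReal.ofReal (Real.exp (blockIndex pop (fun s => dir b (y s)) S g)))]
    · refine (Finset.prod_le_prod' fun g _ =>
        lintegral_exp_blockIndex_le hY hind pop b S hS g).trans ?_
      simp
    · intro g y y' h
      have : ∑ s ∈ S with pop s = g, dir b (y s) = ∑ s ∈ S with pop s = g, dir b (y' s) :=
        Finset.sum_congr rfl fun s hs => by rw [h s (Finset.mem_filter.1 hs).2]
      simp only [blockIndex, this]
  have hmeas : Measurable fun ω =>
      ENNReal.ofReal (Real.exp (signalIndex pop (fun s => dir b (Y s ω)) S)) :=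
    (Measurable.of_discrete (f := fun y : ι → Bool =>
      ENNReal.ofReal (Real.exp (signalIndex pop (fun s => dir b (y s)) S)))).comp
      (measurable_pi_lambda _ hY)
  have hmk := mul_meas_ge_le_lintegral hmeas (μ := μ) (ENNReal.ofReal (Real.exp T))
  have hsub : {ω | T < signalIndex pop (fun s => dir b (Y s ω)) S} ⊆ {ω | ENNReal.ofReal (Real.exp T)
      ≤ ENNReal.ofReal (Real.exp (signalIndex pop (fun s => dir b (Y s ω)) S))} := fun ω hω =>
    ENNReal.ofReal_le_ofReal (Real.exp_le_exp.2 (le_of_lt hω))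
  calc μ {ω | T < signalIndex pop (fun s => dir b (Y s ω)) S}
      = (ENNReal.ofReal (Real.exp T) * μ {ω | T < signalIndex pop (fun s => dir b (Y s ω)) S}) *
          ENNReal.ofReal (Real.exp (-T)) := by
        rw [mul_right_comm, ← ENNReal.ofReal_mul (Real.exp_pos _).le, ← Real.exp_add]
        simp
    _ ≤ _ := by
        gcongr
        exact (mul_le_mul_right (measure_mono hsub) _).trans (hmk.trans hprod)

/-! ### The algorithm in terms of balls around the query point -/

section

variable {d m nQ : ℕ} {nP : Fin m → ℕ}

lemma dir_not (b y : Bool) : dir (!b) y = -dir b y := by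
  cases b <;> cases y <;> norm_num [dir]

/-- The observations at the first `k` positions. -/
def firstK (σ : Ordering nQ nP) (k : ℕ) : Finset (SampleIdx nQ nP) :=
  (Finset.univ.filter fun j : Fin (totalSize nQ nP) => (j : ℕ) < k).map σ.toEmbedding

lemma mem_firstK (σ : Ordering nQ nP) (k : ℕ) (s : SampleIdx nQ nP) :
    s ∈ firstK σ k ↔ (σ.symm s : ℕ) < k := by
  simp only [firstK, Finset.mem_map, Finset.mem_filter, Finset.mem_univ, true_and,
    Equiv.coe_toEmbedding]
  constructor
  · rintro ⟨j, hj, rfl⟩; simpa using hj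
  · intro h; exact ⟨σ.symm s, h, by simp⟩

lemma filter_firstK (σ : Ordering nQ nP) (k : ℕ) (g : Option (Fin m)) :
    (firstK σ k).filter (fun s => s.1 = g) = (neighbours σ k g).map σ.toEmbedding := by
  ext s
  simp only [Finset.mem_filter, mem_firstK, Finset.mem_map, neighbours, Finset.mem_univ, true_and,
    Equiv.coe_toEmbedding]
  constructor
  · rintro ⟨h1, h2⟩; exact ⟨σ.symm s, by simpa using ⟨h1, h2⟩, by simp⟩
  · rintro ⟨j, hj, rfl⟩; simpa using hj

lemma etaHat_sub_half (σ : Ordering nQ nP) (y : SampleIdx nQ nP → Bool) (k : ℕ)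
    (g : Option (Fin m)) :
    etaHat σ y k g - 1 / 2 =
      (∑ s ∈ firstK σ k with s.1 = g, dir true (y s)) / (count σ k g : ℝ) := by
  have h : ∀ s, dir true (y s) = (if y s then (1 : ℝ) else 0) - 1 / 2 := by
    intro s; cases y s <;> norm_num [dir]
  rw [filter_firstK, Finset.sum_map]
  simp only [Equiv.coe_toEmbedding, h, Finset.sum_sub_distrib, Finset.sum_const, nsmul_eq_mul]
  unfold etaHat
  -- The default estimate `1/2` for an empty population agrees with the convention `0 / 0 = 0` on
  -- the right.
  by_cases hc : count σ k g = 0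
  · simp [hc]
  · rw [if_neg hc]
    have : (count σ k g : ℝ) ≠ 0 := by exact_mod_cast hc
    change _ = (_ - (count σ k g : ℝ) * (1 / 2)) / _
    field_simp

lemma blockIndex_firstK (σ : Ordering nQ nP) (w : SampleIdx nQ nP → ℝ) (k : ℕ)
    (g : Option (Fin m)) :
    blockIndex (fun s : SampleIdx nQ nP => s.1) w (firstK σ k) g =
      (count σ k g : ℝ) *
        (max ((∑ s ∈ firstK σ k with s.1 = g, w s) / (count σ k g : ℝ)) 0) ^ 2 := by
  have hcard : ((firstK σ k).filter (fun s => s.1 = g)).card = count σ k g := by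
    rw [filter_firstK, Finset.card_map, count]
  unfold blockIndex
  rw [hcard]
  rcases Nat.eq_zero_or_pos (count σ k g) with hc | hc
  · simp [hc]
  · have hc' : (0 : ℝ) < count σ k g := by exact_mod_cast hc
    have : max ((∑ s ∈ firstK σ k with s.1 = g, w s) / (count σ k g : ℝ)) 0 =
        max (∑ s ∈ firstK σ k with s.1 = g, w s) 0 / (count σ k g : ℝ) := by
      rw [← max_div_div_right hc'.le, zero_div]
    rw [this]; field_simp

/-- The indicator in the index is absorbed by the positive part, because an estimate equal to `1/2`
contributes zero. Both indices thus become one functional evaluated in opposite directions, which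
lets the two labels be treated together. -/
lemma rPos_eq (σ : Ordering nQ nP) (y : SampleIdx nQ nP → Bool) (k : ℕ) :
    rPos σ y k = signalIndex (fun s : SampleIdx nQ nP => s.1) (fun s => dir true (y s))
      (firstK σ k) := by
  refine Finset.sum_congr rfl fun g _ => ?_
  rw [blockIndex_firstK, ← etaHat_sub_half]
  split_ifs with h
  · rw [max_eq_left (by linarith)]
  · rw [max_eq_right (by linarith)]; simp

lemma rNeg_eq (σ : Ordering nQ nP) (y : SampleIdx nQ nP → Bool) (k : ℕ) :
    rNeg σ y k = signalIndex (fun s : SampleIdx nQ nP => s.1) (fun s => dir false (y s))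
      (firstK σ k) := by
  refine Finset.sum_congr rfl fun g _ => ?_
  have h1 : ∀ s, dir false (y s) = -dir true (y s) := fun s => dir_not true (y s)
  rw [blockIndex_firstK]
  simp only [h1, Finset.sum_neg_distrib, neg_div]
  rw [← etaHat_sub_half]
  split_ifs with h
  · rw [max_eq_left (by linarith)]; ring
  · rw [max_eq_right (by linarith)]; simp

lemma rHat_eq (σ : Ordering nQ nP) (y : SampleIdx nQ nP → Bool) (k : ℕ) (b : Bool) :
    rHat σ y k = max
      (signalIndex (fun s : SampleIdx nQ nP => s.1) (fun s => dir b (y s)) (firstK σ k))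
      (signalIndex (fun s : SampleIdx nQ nP => s.1) (fun s => dir (!b) (y s)) (firstK σ k)) := by
  cases b
  · rw [rHat, rPos_eq, rNeg_eq, max_comm]; rfl
  · rw [rHat, rPos_eq, rNeg_eq]; rfl

lemma stepClassifier_eq (σ : Ordering nQ nP) (y : SampleIdx nQ nP → Bool) (k : ℕ) (b : Bool)
    (h : signalIndex (fun s : SampleIdx nQ nP => s.1) (fun s => dir (!b) (y s)) (firstK σ k) <
      signalIndex (fun s : SampleIdx nQ nP => s.1) (fun s => dir b (y s)) (firstK σ k)) :
    stepClassifier σ y k = b := by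
  unfold stepClassifier
  rw [rPos_eq, rNeg_eq]
  cases b
  · exact if_neg (not_le.2 h)
  · rw [if_pos (by simpa using h.le)]

/-- The observations whose covariates lie in the closed ball around `x` of radius `r`. -/
def inBall {ι : Type*} [Fintype ι] (Z : ι → Feature d × Bool) (x : Feature d) (r : ℝ) : Finset ι :=
  Finset.univ.filter fun s => ‖(Z s).1 - x‖ ≤ r

lemma mem_inBall {ι : Type*} [Fintype ι] (Z : ι → Feature d × Bool) (x : Feature d) (r : ℝ) (s : ι) :
    s ∈ inBall Z x r ↔ ‖(Z s).1 - x‖ ≤ r := by simp [inBall]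

/-- A closed ball is a down-set for the distance order, so its members fill an initial segment of
positions. Ties do no harm, as tied points are all inside or all outside. -/
lemma firstK_card_inBall {Z : Data d nQ nP} {x : Feature d} {σ : Ordering nQ nP}
    (hσ : IsNeighbourOrdering Z x σ) (r : ℝ) :
    firstK σ (inBall Z x r).card = inBall Z x r := by
  have hmono : ∀ i j, i ≤ j → σ j ∈ inBall Z x r → σ i ∈ inBall Z x r := by
    intro i j hij hj
    rw [mem_inBall] at hj ⊢
    exact (hσ hij).trans hj
  have hcard : (inBall Z x r).card =
      (Finset.univ.filter fun j => σ j ∈ inBall Z x r).card := by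
    rw [← Finset.card_map σ.toEmbedding]
    congr 1
    ext s
    simp only [Finset.mem_map, Finset.mem_filter, Finset.mem_univ, true_and,
      Equiv.coe_toEmbedding]
    exact ⟨fun h => ⟨σ.symm s, by simpa using h, by simp⟩, by rintro ⟨j, hj, rfl⟩; exact hj⟩
  ext s
  obtain ⟨j, rfl⟩ := σ.surjective s
  rw [mem_firstK, hcard, Equiv.symm_apply_apply]
  constructor
  · intro h
    by_contra hj
    have hsub : (Finset.univ.filter fun i => σ i ∈ inBall Z x r) ⊆ Finset.Iio j := by
      intro i hi
      rw [Finset.mem_Iio]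
      by_contra hij
      exact hj (hmono j i (not_lt.1 hij) (Finset.mem_filter.1 hi).2)
    have := Finset.card_le_card hsub
    rw [Fin.card_Iio] at this
    omega
  · intro hj
    have hsub : Finset.Iic j ⊆ (Finset.univ.filter fun i => σ i ∈ inBall Z x r) := fun i hi =>
      Finset.mem_filter.2 ⟨Finset.mem_univ _, hmono i j (Finset.mem_Iic.1 hi) hj⟩
    have := Finset.card_le_card hsub
    rw [Fin.card_Iic] at this
    omega

/-- Without ties, neighbour sets are balls through sample points and no longer mention the ordering.
This leaves only as many sets for the union bound as there are observations. Positions start at `0`,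
hence the successor. -/
lemma firstK_succ_eq_inBall {Z : Data d nQ nP} {x : Feature d} {σ : Ordering nQ nP}
    (hσ : IsNeighbourOrdering Z x σ) (hinj : Function.Injective fun s => ‖(Z s).1 - x‖)
    (j : Fin (totalSize nQ nP)) :
    firstK σ (j + 1) = inBall Z x ‖(Z (σ j)).1 - x‖ := by
  have hst : StrictMono fun j => ‖(Z (σ j)).1 - x‖ :=
    hσ.strictMono_of_injective (hinj.comp σ.injective)
  ext s
  obtain ⟨i, rfl⟩ := σ.surjective s
  rw [mem_firstK, mem_inBall, Equiv.symm_apply_apply, Nat.lt_succ_iff]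
  exact (hst.le_iff_le (a := i) (b := j)).symm

/-- The adaptive classifier returns the label `b` if the index in the direction of `b` of the
observations in a ball is large and the index in the opposite direction of the observations in each
smaller ball is small. -/
lemma IsOutput.eq_of_signalIndex {Z : Data d nQ nP} {x : Feature d} {σ : Ordering nQ nP}
    (hσ : IsNeighbourOrdering Z x σ) (hinj : Function.Injective fun s => ‖(Z s).1 - x‖)
    {out : Bool} (hout : IsOutput d σ (fun s => (Z s).2) out) (b : Bool) (r : ℝ)
    (hT : 0 ≤ threshold d (totalSize nQ nP))
    (h1 : threshold d (totalSize nQ nP) < signalIndex (fun s : SampleIdx nQ nP => s.1)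
      (fun s => dir b (Z s).2) (inBall Z x r))
    (h2 : ∀ s, ‖(Z s).1 - x‖ ≤ r → signalIndex (fun s : SampleIdx nQ nP => s.1)
      (fun s => dir (!b) (Z s).2) (inBall Z x ‖(Z s).1 - x‖) ≤ threshold d (totalSize nQ nP)) :
    out = b := by
  set k₀ := (inBall Z x r).card with hk₀
  have hn : Fintype.card (SampleIdx nQ nP) = totalSize nQ nP := by
    rw [← Fintype.card_congr σ, Fintype.card_fin]
  have hk₀n : k₀ ≤ totalSize nQ nP := hn ▸ Finset.card_le_univ _
  have hk₀1 : 1 ≤ k₀ := by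
    rw [Nat.one_le_iff_ne_zero, hk₀, Finset.card_ne_zero, Finset.nonempty_iff_ne_empty]
    -- An empty ball has index `0`, which cannot exceed the nonnegative threshold.
    intro he
    rw [he] at h1
    simp only [signalIndex, blockIndex] at h1
    simp at h1
    linarith
  have hr : threshold d (totalSize nQ nP) < rHat σ (fun s => (Z s).2) k₀ := by
    rw [rHat_eq σ _ _ b, firstK_card_inBall hσ]
    exact lt_max_of_lt_left h1
  obtain ⟨k, hk, hcase, rfl⟩ := hout
  rw [Finset.mem_Icc] at hk
  rcases hcase with ⟨hlt, hmin⟩ | ⟨hall, -⟩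
  -- The threshold is already exceeded at `k₀`, so the first crossing `k` comes no later and its
  -- neighbour set is one of the smaller balls covered by `h2`.
  · have hkk : k ≤ k₀ := by
      by_contra hc
      exact absurd hr (not_lt.2 (hmin k₀ (Finset.mem_Ico.2 ⟨hk₀1, not_le.1 hc⟩)))
    let j : Fin (totalSize nQ nP) := ⟨k - 1, by omega⟩
    have hj : (j : ℕ) + 1 = k := by simp only [j]; omega
    have hjb : ‖(Z (σ j)).1 - x‖ ≤ r := by
      rw [← mem_inBall, ← firstK_card_inBall hσ, mem_firstK, Equiv.symm_apply_apply]
      omega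
    have h3 := h2 _ hjb
    rw [← firstK_succ_eq_inBall hσ hinj, hj] at h3
    refine stepClassifier_eq _ _ _ _ (h3.trans_lt ?_)
    rw [rHat_eq σ _ _ b] at hlt
    exact (lt_max_iff.1 hlt).resolve_right (not_lt.2 h3)
  -- The fallback to a maximizer is excluded, since the index at `k₀` exceeds the threshold.
  · exact absurd hr (not_lt.2 (hall k₀ (Finset.mem_Icc.2 ⟨hk₀1, hk₀n⟩)))

end

/-! ### Labels from independent uniform variables, and absence of ties -/

section

variable {d : ℕ}

/-- The uniform distribution on the unit interval. -/
def unif : Measure ℝ := volume.restrict (Set.Icc 0 1)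

instance : IsProbabilityMeasure unif := ⟨by simp [unif]⟩

lemma unif_Iic {p : ℝ} (hp : p ∈ Set.Icc (0 : ℝ) 1) : unif (Set.Iic p) = ENNReal.ofReal p := by
  have : Set.Iic p ∩ Set.Icc 0 1 = Set.Icc 0 p := by
    ext u; simp only [Set.mem_inter_iff, Set.mem_Iic, Set.mem_Icc]
    exact ⟨fun h => ⟨h.2.1, h.1⟩, fun h => ⟨h.2, h.1, h.2.trans hp.2⟩⟩
  rw [unif, Measure.restrict_apply measurableSet_Iic, this]; simp

lemma unif_Ioi {p : ℝ} (hp : p ∈ Set.Icc (0 : ℝ) 1) :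
    unif (Set.Ioi p) = ENNReal.ofReal (1 - p) := by
  rw [← Set.compl_Iic, prob_compl_eq_one_sub measurableSet_Iic, unif_Iic hp,
    ENNReal.ofReal_sub _ hp.1, ENNReal.ofReal_one]

lemma lintegral_unif_decide {p : ℝ} (hp : p ∈ Set.Icc (0 : ℝ) 1) (G : Bool → ℝ≥0∞) :
    ∫⁻ u, G (decide (u ≤ p)) ∂unif =
      ENNReal.ofReal p * G true + ENNReal.ofReal (1 - p) * G false := by
  rw [← lintegral_add_compl _ (measurableSet_Iic (a := p)), Set.compl_Iic]
  congr 1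
  · rw [setLIntegral_congr_fun (g := fun _ => G true) measurableSet_Iic fun u hu => by
      simp [Set.mem_Iic.1 hu], setLIntegral_const, unif_Iic hp, mul_comm]
  · rw [setLIntegral_congr_fun (g := fun _ => G false) measurableSet_Ioi fun u hu => by
      simp [not_le.2 (Set.mem_Ioi.1 hu)], setLIntegral_const, unif_Ioi hp, mul_comm]

lemma marginal_apply (P : Measure (Feature d × Bool)) {A : Set (Feature d)}
    (hA : MeasurableSet A) : marginal P A = P (A ×ˢ Set.univ) := by
  rw [marginal, Measure.map_apply measurable_fst hA]; congr 1; ext z; simp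

instance (P : Measure (Feature d × Bool)) [IsProbabilityMeasure P] :
    IsProbabilityMeasure (marginal P) := Measure.isProbabilityMeasure_map measurable_fst.aemeasurable

lemma prod_univ_bool (A : Set (Feature d)) :
    A ×ˢ (Set.univ : Set Bool) = A ×ˢ {true} ∪ A ×ˢ {false} := by
  ext ⟨x, b⟩; cases b <;> simp

lemma IsRegressionFunction.measure_prod_false {P : Measure (Feature d × Bool)}
    [IsProbabilityMeasure P] {η : Feature d → ℝ} (h : IsRegressionFunction P η)
    {A : Set (Feature d)} (hA : MeasurableSet A) :
    P (A ×ˢ {false}) = ∫⁻ x in A, ENNReal.ofReal (1 - η x) ∂(marginal P) := by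
  have h1 : marginal P A = P (A ×ˢ {true}) + P (A ×ˢ {false}) := by
    rw [marginal_apply P hA, prod_univ_bool, measure_union _ (hA.prod (measurableSet_singleton _))]
    rw [Set.disjoint_left]; rintro ⟨x, b⟩ ⟨-, h1⟩ ⟨-, h2⟩; simp_all
  have h2 : marginal P A = P (A ×ˢ {true}) +
      ∫⁻ x in A, ENNReal.ofReal (1 - η x) ∂(marginal P) := by
    rw [h.condProb A hA, ← lintegral_add_left (by have := h.measurable; fun_prop)]
    have : ∀ x, ENNReal.ofReal (η x) + ENNReal.ofReal (1 - η x) = 1 := fun x => by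
      rw [← ENNReal.ofReal_add (h.mem_Icc x).1 (by linarith [(h.mem_Icc x).2])]; simp
    simp [this]
  exact (ENNReal.add_right_inj (measure_ne_top P (A ×ˢ {true}))).1 (h1.symm.trans h2)

lemma measurable_label {η : Feature d → ℝ} (hη : Measurable η) :
    Measurable fun w : Feature d × ℝ => (w.1, decide (w.2 ≤ η w.1)) :=
  measurable_fst.prodMk (measurable_to_bool (by
    have : (fun w : Feature d × ℝ => decide (w.2 ≤ η w.1)) ⁻¹' {true} =
        {w | w.2 ≤ η w.1} := by ext; simp
    rw [this]; exact measurableSet_le measurable_snd (by fun_prop)))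

/-- The label can be generated from the covariate and an independent uniform variable. -/
lemma IsRegressionFunction.eq_map {P : Measure (Feature d × Bool)}
    [IsProbabilityMeasure P] {η : Feature d → ℝ} (h : IsRegressionFunction P η) :
    P = ((marginal P).prod unif).map fun w => (w.1, decide (w.2 ≤ η w.1)) := by
  have hη := h.measurable
  have hm := measurable_label hη
  ext E hE
  have hs : ∀ b, MeasurableSet {x | (x, b) ∈ E} := fun b => hE.preimage (by fun_prop)
  rw [Measure.map_apply hm hE, Measure.prod_apply (hm hE)]
  have h1 : ∀ x, unif (Prod.mk x ⁻¹' ((fun w : Feature d × ℝ => (w.1, decide (w.2 ≤ η w.1))) ⁻¹' E))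
      = {x | (x, true) ∈ E}.indicator (fun x => ENNReal.ofReal (η x)) x +
        {x | (x, false) ∈ E}.indicator (fun x => ENNReal.ofReal (1 - η x)) x := by
    intro x
    have hmx : MeasurableSet
        (Prod.mk x ⁻¹' ((fun w : Feature d × ℝ => (w.1, decide (w.2 ≤ η w.1))) ⁻¹' E)) :=
      (hm hE).preimage (by fun_prop)
    rw [← lintegral_indicator_one hmx]
    have := lintegral_unif_decide (h.mem_Icc x) (fun b => E.indicator 1 (x, b))
    refine Eq.trans ?_ (this.trans ?_)
    · rfl
    · by_cases ht : (x, true) ∈ E <;> by_cases hf : (x, false) ∈ E <;> simp [ht, hf]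
  simp only [h1]
  rw [lintegral_add_left ((by fun_prop : Measurable fun x => ENNReal.ofReal (η x)).indicator
    (hs true)), lintegral_indicator (hs true), lintegral_indicator (hs false),
    ← h.condProb _ (hs true), ← h.measure_prod_false (hs false), ← measure_union]
  · congr 1; ext ⟨x, b⟩; cases b <;> simp
  · rw [Set.disjoint_left]; rintro ⟨x, b⟩ ⟨-, h1⟩ ⟨-, h2⟩; simp_all
  · exact (hs false).prod (measurableSet_singleton _)

lemma IsRegressionFunction.lintegral_eq {P : Measure (Feature d × Bool)}
    [IsProbabilityMeasure P] {η : Feature d → ℝ} (h : IsRegressionFunction P η)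
    {F : Feature d × Bool → ℝ≥0∞} (hF : Measurable F) :
    ∫⁻ z, F z ∂P = ∫⁻ x, (ENNReal.ofReal (η x) * F (x, true) +
      ENNReal.ofReal (1 - η x) * F (x, false)) ∂(marginal P) := by
  have hm := measurable_label h.measurable
  conv_lhs => rw [h.eq_map]
  have hFm : Measurable fun w : Feature d × ℝ => F (w.1, decide (w.2 ≤ η w.1)) := hF.comp hm
  rw [lintegral_map hF hm, lintegral_prod _ hFm.aemeasurable]
  exact lintegral_congr fun x => lintegral_unif_decide (h.mem_Icc x) fun b => F (x, b)

/-- Independent observations can be generated from the covariates and independent uniform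
variables. -/
lemma pi_eq_map_label {ι : Type*} [Fintype ι] {L : ι → Measure (Feature d × Bool)}
    [∀ s, IsProbabilityMeasure (L s)] {η : ι → Feature d → ℝ}
    (h : ∀ s, IsRegressionFunction (L s) (η s)) :
    Measure.pi L = ((Measure.pi fun s => marginal (L s)).prod (Measure.pi fun _ => unif)).map
      fun w s => (w.1 s, decide (w.2 s ≤ η s (w.1 s))) := by
  have hm := fun s => measurable_label (h s).measurable
  have h1 : Measure.pi L = Measure.pi fun s =>
      ((marginal (L s)).prod unif).map fun w => (w.1, decide (w.2 ≤ η s w.1)) := by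
    congr 1; funext s; exact (h s).eq_map
  have : ∀ s, IsProbabilityMeasure
      (((marginal (L s)).prod unif).map fun w => (w.1, decide (w.2 ≤ η s w.1))) := fun s =>
    Measure.isProbabilityMeasure_map (hm s).aemeasurable
  -- Regrouping the pairs separates all covariates from all uniforms, so that Fubini can freeze the
  -- covariates and keep the labels independent.
  have hmp := (measurePreserving_arrowProdEquivProdArrow (Feature d) ℝ ι
    (fun s => marginal (L s)) fun _ => unif).symm
  rw [h1, ← Measure.pi_map_pi fun s => (hm s).aemeasurable, ← hmp.map_eq,
    Measure.map_map _ hmp.measurable]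
  · rfl
  · exact measurable_pi_lambda _ fun s => (hm s).comp (measurable_pi_apply s)

/-- Distances to a fixed point from independent covariates with densities almost surely have no
ties. -/
lemma ae_injective_dist (hd : 1 ≤ d) {ι : Type*} [Fintype ι] {L : ι → Measure (Feature d × Bool)}
    [∀ s, IsProbabilityMeasure (L s)] (hac : ∀ s, marginal (L s) ≪ volume) (x : Feature d) :
    ∀ᵐ Z ∂(Measure.pi L), Function.Injective fun s => ‖(Z s).1 - x‖ := by
  -- Positive dimension is what makes every sphere, including that of radius `0`, Lebesgue null.
  have : Nonempty (Fin d) := ⟨⟨0, hd⟩⟩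
  have key : ∀ s s' : ι, s ≠ s' → ∀ᵐ Z ∂(Measure.pi L), ‖(Z s).1 - x‖ ≠ ‖(Z s').1 - x‖ := by
    intro s s' hss
    have hind : iIndepFun (fun s (Z : ι → Feature d × Bool) => Z s) (Measure.pi L) :=
      iIndepFun_pi (X := fun _ z => z) fun s => measurable_id.aemeasurable
    have hpair := (hind.indepFun hss).comp (φ := Prod.fst) (ψ := Prod.fst)
      measurable_fst measurable_fst
    have hms : ∀ s, Measurable fun Z : ι → Feature d × Bool => (Z s).1 := fun s => by fun_prop
    have hmap : ∀ s, (Measure.pi L).map (fun Z => (Z s).1) = marginal (L s) := fun s => by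
      rw [marginal, ← (measurePreserving_eval L s).map_eq,
        Measure.map_map measurable_fst (measurable_pi_apply s)]; rfl
    have hlaw := (indepFun_iff_map_prod_eq_prod_map_map (hms s).aemeasurable
      (hms s').aemeasurable).1 hpair
    rw [hmap s, hmap s'] at hlaw
    have hE : MeasurableSet {z : Feature d × Feature d | ‖z.1 - x‖ = ‖z.2 - x‖} :=
      measurableSet_eq_fun (by fun_prop) (by fun_prop)
    have h0 : ((marginal (L s)).prod (marginal (L s')))
        {z : Feature d × Feature d | ‖z.1 - x‖ = ‖z.2 - x‖} = 0 := by
      rw [Measure.measure_prod_null hE]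
      refine Filter.Eventually.of_forall fun y => hac s' ?_
      have : Prod.mk y ⁻¹' {z : Feature d × Feature d | ‖z.1 - x‖ = ‖z.2 - x‖} =
          Metric.sphere x ‖y - x‖ := by
        ext z; simp [mem_sphere_iff_norm, eq_comm]
      rw [this]; exact Measure.addHaar_sphere _ _ _
    rw [← hlaw, Measure.map_apply ((hms s).prodMk (hms s')) hE] at h0
    exact measure_eq_zero_iff_ae_notMem.1 h0
  have h2 : ∀ᵐ Z ∂(Measure.pi L), ∀ s s' : ι, s ≠ s' → ‖(Z s).1 - x‖ ≠ ‖(Z s').1 - x‖ :=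
    ae_all_iff.2 fun s => ae_all_iff.2 fun s' => by
      by_cases hss : s = s'
      · simp [hss]
      · simpa [hss] using key s s' hss
  filter_upwards [h2] with Z hZ s s' hss
  by_contra hne
  exact hZ s s' hne hss

end

/-! ### Deviation bounds in balls around a fixed point -/

section

variable {d : ℕ}

/-- The probability of the label `b` when the label `1` has probability `p`. -/
def labelProb (b : Bool) (p : ℝ) : ℝ := if b then p else 1 - p

lemma unif_decide_eq (b : Bool) {p : ℝ} (hp : p ∈ Set.Icc (0 : ℝ) 1) :
    unif.real {u | decide (u ≤ p) = b} = labelProb b p := by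
  cases b
  · have : {u | decide (u ≤ p) = false} = Set.Ioi p := by ext; simp
    rw [this, measureReal_def, unif_Ioi hp, ENNReal.toReal_ofReal (by linarith [hp.2])]
    simp [labelProb]
  · have : {u | decide (u ≤ p) = true} = Set.Iic p := by ext; simp
    rw [this, measureReal_def, unif_Iic hp, ENNReal.toReal_ofReal hp.1]
    simp [labelProb]

lemma measurableSet_inBall_eq {ι : Type*} [Fintype ι] (x : Feature d)
    {ρ : (ι → Feature d × Bool) → ℝ} (hρ : Measurable ρ) (S : Finset ι) :
    MeasurableSet {Z | inBall Z x (ρ Z) = S} := by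
  have : {Z | inBall Z x (ρ Z) = S} = ⋂ s, {Z | ‖(Z s).1 - x‖ ≤ ρ Z ↔ s ∈ S} := by
    ext Z; simp [Finset.ext_iff, mem_inBall]
  rw [this]
  refine MeasurableSet.iInter fun s => ?_
  have h : MeasurableSet {Z : ι → Feature d × Bool | ‖(Z s).1 - x‖ ≤ ρ Z} :=
    measurableSet_le (by fun_prop) hρ
  by_cases hs : s ∈ S
  · simpa [hs] using h
  · simp only [hs, iff_false]; exact h.compl

/-- The radius may depend on the data, but the set of observations in the ball takes finitely many
values; on each of them the index is a function of the labels alone. -/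
lemma measurableSet_signalIndex_gt {ι G : Type*} [Fintype ι] [Fintype G] [DecidableEq G]
    (pop : ι → G) (b : Bool) (T : ℝ) (x : Feature d)
    {ρ : (ι → Feature d × Bool) → ℝ} (hρ : Measurable ρ) :
    MeasurableSet {Z : ι → Feature d × Bool |
      T < signalIndex pop (fun s => dir b (Z s).2) (inBall Z x (ρ Z))} := by
  have : {Z : ι → Feature d × Bool |
      T < signalIndex pop (fun s => dir b (Z s).2) (inBall Z x (ρ Z))} =
      ⋃ S : Finset ι, {Z | inBall Z x (ρ Z) = S} ∩
        {Z | T < signalIndex pop (fun s => dir b (Z s).2) S} := by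
    ext Z
    simp only [Set.mem_iUnion, Set.mem_inter_iff, Set.mem_ofPred_eq, exists_eq_left']
  rw [this]
  refine MeasurableSet.iUnion fun S => (measurableSet_inBall_eq x hρ S).inter ?_
  have hm : Measurable fun Z : ι → Feature d × Bool => fun s => (Z s).2 := by fun_prop
  have hf : Measurable fun y : ι → Bool => signalIndex pop (fun s => dir b (y s)) S :=
    Measurable.of_discrete
  exact measurableSet_lt measurable_const (hf.comp hm)

/-- If in the ball of radius `r` around `x` the label `b` is never the more likely one, then a large
signal-to-noise index in the direction of `b` in some smaller ball is unlikely. -/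
lemma measure_exists_signalIndex_gt_le {ι G : Type*} [Fintype ι] [Fintype G] [DecidableEq G]
    (pop : ι → G) {L : ι → Measure (Feature d × Bool)}
    [∀ s, IsProbabilityMeasure (L s)] {η : ι → Feature d → ℝ}
    (h : ∀ s, IsRegressionFunction (L s) (η s)) (b : Bool) (T : ℝ) (x : Feature d) (r : ℝ)
    (hb : ∀ s, ∀ᵐ x' ∂(marginal (L s)), ‖x' - x‖ ≤ r → labelProb b (η s x') ≤ 1 / 2) :
    Measure.pi L {Z | ∃ s₀, ‖(Z s₀).1 - x‖ ≤ r ∧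
      T < signalIndex pop (fun s => dir b (Z s).2) (inBall Z x ‖(Z s₀).1 - x‖)} ≤
      Fintype.card ι * (expMomentBound ^ Fintype.card G * ENNReal.ofReal (Real.exp (-T))) := by
  classical
  have hE : MeasurableSet {Z : ι → Feature d × Bool | ∃ s₀, ‖(Z s₀).1 - x‖ ≤ r ∧
      T < signalIndex pop (fun s => dir b (Z s).2) (inBall Z x ‖(Z s₀).1 - x‖)} := by
    simp only [Set.ofPred_exists]
    refine MeasurableSet.iUnion fun s₀ => ?_
    have hρ : Measurable fun Z : ι → Feature d × Bool => ‖(Z s₀).1 - x‖ := by fun_prop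
    exact (measurableSet_le hρ measurable_const).inter (measurableSet_signalIndex_gt pop b T x hρ)
  have hm : Measurable fun (w : (ι → Feature d) × (ι → ℝ)) s =>
      (w.1 s, decide (w.2 s ≤ η s (w.1 s))) :=
    measurable_pi_lambda _ fun s => (measurable_label (h s).measurable).comp
      (f := fun w : (ι → Feature d) × (ι → ℝ) => (w.1 s, w.2 s)) (by fun_prop)
  -- Given the covariates, the balls are deterministic sets and the bound for a fixed set applies to
  -- each.
  rw [pi_eq_map_label h, Measure.map_apply hm hE, Measure.prod_apply (hm hE)]
  have hae : ∀ᵐ X ∂(Measure.pi fun s => marginal (L s)), ∀ s, ‖X s - x‖ ≤ r →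
      labelProb b (η s (X s)) ≤ 1 / 2 := ae_all_iff.2 fun s =>
    (Measure.quasiMeasurePreserving_eval (fun s => marginal (L s)) s).ae (hb s)
  refine (lintegral_mono_ae (g := fun _ => Fintype.card ι * (expMomentBound ^ Fintype.card G *
    ENNReal.ofReal (Real.exp (-T)))) ?_).trans (by simp)
  filter_upwards [hae] with X hX
  set Y : ι → (ι → ℝ) → Bool := fun s u => decide (u s ≤ η s (X s)) with hY
  have hYm1 : ∀ s, Measurable fun u : ℝ => decide (u ≤ η s (X s)) := fun s =>
    measurable_to_bool (by
      have : (fun u : ℝ => decide (u ≤ η s (X s))) ⁻¹' {true} = Set.Iic (η s (X s)) := by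
        ext; simp
      rw [this]; exact measurableSet_Iic)
  have hYm : ∀ s, Measurable (Y s) := fun s => (hYm1 s).comp (measurable_pi_apply s)
  have hind : iIndepFun Y (Measure.pi fun _ : ι => unif) :=
    iIndepFun_pi (X := fun s u => decide (u ≤ η s (X s))) fun s => (hYm1 s).aemeasurable
  let S : ι → Finset ι := fun s₀ => Finset.univ.filter fun s => ‖X s - x‖ ≤ ‖X s₀ - x‖
  have hsub : (Prod.mk X ⁻¹' ((fun (w : (ι → Feature d) × (ι → ℝ)) s =>
      (w.1 s, decide (w.2 s ≤ η s (w.1 s)))) ⁻¹' {Z | ∃ s₀, ‖(Z s₀).1 - x‖ ≤ r ∧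
      T < signalIndex pop (fun s => dir b (Z s).2) (inBall Z x ‖(Z s₀).1 - x‖)})) ⊆
      ⋃ s₀, {u | ‖X s₀ - x‖ ≤ r ∧ T < signalIndex pop (fun s => dir b (Y s u)) (S s₀)} := by
    intro u hu
    obtain ⟨s₀, h1, h2⟩ := hu
    exact Set.mem_iUnion.2 ⟨s₀, h1, h2⟩
  refine (measure_mono hsub).trans ((measure_iUnion_fintype_le _ _).trans ?_)
  refine (Finset.sum_le_card_nsmul _ _ _ fun s₀ _ => ?_).trans_eq (by
    rw [nsmul_eq_mul, Finset.card_univ])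
  by_cases hs₀ : ‖X s₀ - x‖ ≤ r
  · simp only [hs₀, true_and]
    refine measure_signalIndex_gt_le hYm hind pop b (S s₀) (fun s hs => ?_) T
    have h1 : (Measure.pi fun _ : ι => unif).real {u | Y s u = b} = labelProb b (η s (X s)) := by
      rw [← unif_decide_eq b ((h s).mem_Icc _), measureReal_def, measureReal_def]
      exact congrArg ENNReal.toReal ((measurePreserving_eval (fun _ : ι => unif) s).measure_preimage
        ((hYm1 s) (measurableSet_singleton b)).nullMeasurableSet)
    rw [h1]
    exact hX s ((Finset.mem_filter.1 hs).2.trans hs₀)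
  · simp [hs₀]

/-- Chernoff bound for one label at parameter `2v`. The shift `v/4` costs `e^(v²/2)`, and the rest
is `cosh v - (2q-1) sinh v ≤ (1 + v²) - 2v² ≤ (1 - v²/2)²`. One of the two factors cancels the cost,
by `1 - w ≤ e^(-w)`. -/
lemma exp_mixture_le {q v : ℝ} (hv0 : 0 ≤ v) (hv : v ≤ 1 / 2) (hq : 1 / 2 + v ≤ q) :
    q * Real.exp (-(2 * v) * (1 / 2 - v / 4)) + (1 - q) * Real.exp (-(2 * v) * (-(1 / 2) - v / 4)) ≤
      1 - v ^ 2 / 2 := by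
  have e1 : Real.exp (-(2 * v) * (1 / 2 - v / 4)) = Real.exp (v ^ 2 / 2) * Real.exp (-v) := by
    rw [← Real.exp_add]; congr 1; ring
  have e2 : Real.exp (-(2 * v) * (-(1 / 2) - v / 4)) = Real.exp (v ^ 2 / 2) * Real.exp v := by
    rw [← Real.exp_add]; congr 1; ring
  have h1 : q * Real.exp (-v) + (1 - q) * Real.exp v = Real.cosh v - (2 * q - 1) * Real.sinh v := by
    rw [Real.cosh_eq, Real.sinh_eq]; ring
  have hs : v ≤ Real.sinh v := Real.self_le_sinh_iff.2 hv0
  have hw : v ^ 2 / 2 ≤ 1 / 8 := by nlinarith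
  have hexp : Real.exp (v ^ 2 / 2) * (1 - v ^ 2 / 2) ≤ 1 := by
    have := Real.add_one_le_exp (-(v ^ 2 / 2))
    calc _ ≤ Real.exp (v ^ 2 / 2) * Real.exp (-(v ^ 2 / 2)) := by gcongr; linarith
      _ = 1 := by rw [← Real.exp_add]; simp
  have hpos := Real.exp_pos (v ^ 2 / 2)
  have hexp2 : Real.exp (v ^ 2 / 2) ≤ 1 + v ^ 2 := by nlinarith
  have hc : Real.cosh v ≤ 1 + v ^ 2 := (Real.cosh_le_exp_half_sq v).trans hexp2
  have h2 : Real.cosh v - (2 * q - 1) * Real.sinh v ≤ (1 - v ^ 2 / 2) * (1 - v ^ 2 / 2) := by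
    nlinarith [mul_le_mul (by linarith : 2 * v ≤ 2 * q - 1) hs hv0 (by linarith)]
  calc _ = Real.exp (v ^ 2 / 2) * (q * Real.exp (-v) + (1 - q) * Real.exp v) := by
        rw [e1, e2]; ring
    _ ≤ Real.exp (v ^ 2 / 2) * ((1 - v ^ 2 / 2) * (1 - v ^ 2 / 2)) := by rw [h1]; gcongr
    _ ≤ 1 * (1 - v ^ 2 / 2) := by
        rw [← mul_assoc]; exact mul_le_mul_of_nonneg_right hexp (by linarith)
    _ = _ := one_mul _

/-- The deviation of the label in the direction of `b` over a fraction of the bias `v`, for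
covariates in `B`. -/
def excessDir (B : Set (Feature d)) (b : Bool) (v : ℝ) (z : Feature d × Bool) : ℝ :=
  B.indicator (fun _ => dir b z.2 - v / 4) z.1

lemma measurable_excessDir {B : Set (Feature d)} (hB : MeasurableSet B) (b : Bool) (v : ℝ) :
    Measurable (excessDir B b v) := by
  have h1 : Measurable fun z : Feature d × Bool => dir b z.2 - v / 4 :=
    ((Measurable.of_discrete (f := dir b)).comp measurable_snd).sub_const _
  have h2 : excessDir B b v = (Prod.fst ⁻¹' B).indicator fun z => dir b z.2 - v / 4 := by
    funext z; simp only [excessDir, Set.indicator]; rfl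
  rw [h2]; exact h1.indicator (measurable_fst hB)

/-- The integrand is `1` off `B` and has conditional mean at most `1 - v²/2` on `B`, so its mean is
at most `1 - pv²/2`. -/
lemma lintegral_exp_excessDir_le {P : Measure (Feature d × Bool)} [IsProbabilityMeasure P]
    {η : Feature d → ℝ} (h : IsRegressionFunction P η) {B : Set (Feature d)}
    (hB : MeasurableSet B) (b : Bool) {v p : ℝ} (hv0 : 0 ≤ v) (hv : v ≤ 1 / 2)
    (hbias : ∀ᵐ x ∂(marginal P), x ∈ B → 1 / 2 + v ≤ labelProb b (η x))
    (hp : p ≤ (marginal P).real B) :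
    ∫⁻ z, ENNReal.ofReal (Real.exp (-(2 * v) * excessDir B b v z)) ∂P ≤
      ENNReal.ofReal (Real.exp (-(p * v ^ 2 / 2))) := by
  have hFm : Measurable fun z => ENNReal.ofReal (Real.exp (-(2 * v) * excessDir B b v z)) := by
    have := measurable_excessDir hB b v; fun_prop
  rw [h.lintegral_eq hFm]
  have hv2 : 0 ≤ 1 - v ^ 2 / 2 := by nlinarith
  have hpt : ∀ᵐ x ∂(marginal P), ENNReal.ofReal (η x) *
        ENNReal.ofReal (Real.exp (-(2 * v) * excessDir B b v (x, true))) +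
      ENNReal.ofReal (1 - η x) *
        ENNReal.ofReal (Real.exp (-(2 * v) * excessDir B b v (x, false))) ≤
      B.indicator (fun _ => ENNReal.ofReal (1 - v ^ 2 / 2)) x + Bᶜ.indicator (fun _ => 1) x := by
    filter_upwards [hbias] with x hx
    have h0 := (h.mem_Icc x).1
    have h1 : 0 ≤ 1 - η x := by linarith [(h.mem_Icc x).2]
    rw [← ENNReal.ofReal_mul h0, ← ENNReal.ofReal_mul h1,
      ← ENNReal.ofReal_add (by positivity) (by positivity)]
    by_cases hxB : x ∈ B
    · simp only [excessDir, Set.indicator_of_mem hxB, Set.indicator_of_notMem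
        (Set.notMem_compl_iff.2 hxB), add_zero]
      refine ENNReal.ofReal_le_ofReal ?_
      have := exp_mixture_le hv0 hv (hx hxB)
      cases b
      · simp only [labelProb, dir, Bool.false_eq_true, if_false, Bool.true_eq_false, if_true,
          sub_sub_cancel] at this ⊢
        linarith
      · simp only [labelProb, dir, Bool.false_eq_true, if_false, if_true] at this ⊢
        linarith
    · simp only [excessDir, Set.indicator_of_notMem hxB, Set.indicator_of_mem
        (Set.mem_compl hxB)]
      simp
  refine (lintegral_mono_ae hpt).trans ?_
  rw [lintegral_add_left (measurable_const.indicator hB), lintegral_indicator_const hB,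
    lintegral_indicator_const hB.compl, one_mul, prob_compl_eq_one_sub hB, ← ofReal_measureReal,
    ← ENNReal.ofReal_one, ← ENNReal.ofReal_sub _ measureReal_nonneg, ← ENNReal.ofReal_mul hv2,
    ← ENNReal.ofReal_add (by positivity) (by linarith [measureReal_le_one (μ := marginal P) (s := B)])]
  refine ENNReal.ofReal_le_ofReal ?_
  have := Real.add_one_le_exp (-(p * v ^ 2 / 2))
  nlinarith [mul_le_mul_of_nonneg_right hp (sq_nonneg v)]

/-- Chernoff at parameter `2v`, where the level `T/v` costs `e^(2T)`. Covariates and labels are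
averaged jointly, so no separate bound on the number of points in `B` is needed. -/
lemma measure_sum_excessDir_le {ι G : Type*} [Fintype ι] [DecidableEq G]
    (pop : ι → G) {L : ι → Measure (Feature d × Bool)}
    [∀ s, IsProbabilityMeasure (L s)] {η : ι → Feature d → ℝ}
    (h : ∀ s, IsRegressionFunction (L s) (η s)) (b : Bool) (g : G) {B : Set (Feature d)}
    (hB : MeasurableSet B) {v p : ℝ} (hv0 : 0 < v) (hv : v ≤ 1 / 2)
    (hbias : ∀ s, pop s = g → ∀ᵐ x ∂(marginal (L s)), x ∈ B → 1 / 2 + v ≤ labelProb b (η s x))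
    (hp : ∀ s, pop s = g → p ≤ (marginal (L s)).real B) (T : ℝ) :
    Measure.pi L {Z | ∑ s with pop s = g, excessDir B b v (Z s) ≤ T / v} ≤
      ENNReal.ofReal (Real.exp
        (2 * T - (Finset.univ.filter (pop · = g)).card * (p * v ^ 2 / 2))) := by
  set A := Finset.univ.filter (pop · = g) with hA
  have hm := measurable_excessDir hB b v
  have hFm : Measurable fun z => ENNReal.ofReal (Real.exp (-(2 * v) * excessDir B b v z)) := by
    fun_prop
  have hind : iIndepFun (fun s (Z : ι → Feature d × Bool) =>
      ENNReal.ofReal (Real.exp (-(2 * v) * excessDir B b v (Z s)))) (Measure.pi L) :=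
    iIndepFun_pi (X := fun _ z => ENNReal.ofReal (Real.exp (-(2 * v) * excessDir B b v z)))
      fun s => hFm.aemeasurable
  have hprod : ∫⁻ Z, ∏ s ∈ A, ENNReal.ofReal (Real.exp (-(2 * v) * excessDir B b v (Z s)))
      ∂(Measure.pi L) ≤ ENNReal.ofReal (Real.exp (-(A.card * (p * v ^ 2 / 2)))) := by
    rw [lintegral_prod_eq_prod_lintegral_of_indepFun A _ hind fun s =>
      hFm.comp (measurable_pi_apply s)]
    have : ∀ s ∈ A, ∫⁻ Z, ENNReal.ofReal (Real.exp (-(2 * v) * excessDir B b v (Z s)))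
        ∂(Measure.pi L) ≤ ENNReal.ofReal (Real.exp (-(p * v ^ 2 / 2))) := by
      intro s hs
      have hs' := (Finset.mem_filter.1 hs).2
      rw [(measurePreserving_eval L s).lintegral_comp
        (f := fun z => ENNReal.ofReal (Real.exp (-(2 * v) * excessDir B b v z))) hFm]
      exact lintegral_exp_excessDir_le (h s) hB b hv0.le hv (hbias s hs') (hp s hs')
    refine (Finset.prod_le_prod' this).trans (le_of_eq ?_)
    rw [Finset.prod_const, ← ENNReal.ofReal_pow (Real.exp_pos _).le, ← Real.exp_nat_mul]
    congr 2; ring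
  have hmeas : Measurable fun Z : ι → Feature d × Bool =>
      ∏ s ∈ A, ENNReal.ofReal (Real.exp (-(2 * v) * excessDir B b v (Z s))) :=
    Finset.measurable_prod _ fun s _ => hFm.comp (measurable_pi_apply s)
  have hmk := mul_meas_ge_le_lintegral hmeas (μ := Measure.pi L)
    (ENNReal.ofReal (Real.exp (-(2 * T))))
  have hsub : {Z : ι → Feature d × Bool | ∑ s ∈ A, excessDir B b v (Z s) ≤ T / v} ⊆
      {Z | ENNReal.ofReal (Real.exp (-(2 * T))) ≤
        ∏ s ∈ A, ENNReal.ofReal (Real.exp (-(2 * v) * excessDir B b v (Z s)))} := by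
    intro Z hZ
    simp only [Set.mem_ofPred_eq] at hZ ⊢
    rw [← ENNReal.ofReal_prod_of_nonneg fun _ _ => (Real.exp_pos _).le, ← Real.exp_sum,
      ← Finset.mul_sum]
    refine ENNReal.ofReal_le_ofReal (Real.exp_le_exp.2 ?_)
    rw [le_div_iff₀ hv0] at hZ
    linarith
  calc Measure.pi L {Z | ∑ s ∈ A, excessDir B b v (Z s) ≤ T / v}
      = (ENNReal.ofReal (Real.exp (-(2 * T))) *
          Measure.pi L {Z | ∑ s ∈ A, excessDir B b v (Z s) ≤ T / v}) *
          ENNReal.ofReal (Real.exp (2 * T)) := by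
        rw [mul_right_comm, ← ENNReal.ofReal_mul (Real.exp_pos _).le, ← Real.exp_add]
        simp
    _ ≤ ENNReal.ofReal (Real.exp (-(A.card * (p * v ^ 2 / 2)))) *
          ENNReal.ofReal (Real.exp (2 * T)) := by
        gcongr
        exact (mul_le_mul_right (measure_mono hsub) _).trans (hmk.trans hprod)
    _ = _ := by
        rw [← ENNReal.ofReal_mul (Real.exp_pos _).le, ← Real.exp_add]
        congr 2; ring

/-- With `N` labels of population `g` in the ball and sum `D`, the hypothesis is `D > T/v + vN/4`.
By the arithmetic-geometric mean inequality `D² > TN`, which is the purpose of the shift `v/4`. -/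
lemma signalIndex_gt_of_sum_excessDir_gt {ι G : Type*} [Fintype ι] [Fintype G] [DecidableEq G]
    (pop : ι → G) (b : Bool) (g : G) (Z : ι → Feature d × Bool) (x : Feature d) (r : ℝ)
    {v T : ℝ} (hv : 0 < v) (hT : 0 ≤ T)
    (h : T / v < ∑ s with pop s = g, excessDir (Metric.closedBall x r) b v (Z s)) :
    T < signalIndex pop (fun s => dir b (Z s).2) (inBall Z x r) := by
  classical
  set S := (inBall Z x r).filter (pop · = g) with hS
  have hsum : ∑ s with pop s = g, excessDir (Metric.closedBall x r) b v (Z s) =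
      ∑ s ∈ S, dir b (Z s).2 - v / 4 * S.card := by
    have h1 : S = (Finset.univ.filter (pop · = g)).filter fun s => ‖(Z s).1 - x‖ ≤ r := by
      ext s; simp [hS, mem_inBall, and_comm]
    rw [h1, Finset.sum_filter (fun s => ‖(Z s).1 - x‖ ≤ r), Finset.card_filter]
    push_cast
    rw [Finset.mul_sum, ← Finset.sum_sub_distrib]
    refine Finset.sum_congr rfl fun s _ => ?_
    rw [excessDir, Set.indicator_apply, mem_closedBall_iff_norm]
    split_ifs <;> simp
  rw [hsum] at h
  set D := ∑ s ∈ S, dir b (Z s).2 with hD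
  have hTv : 0 ≤ T / v := by positivity
  have hTv' : T / v * v = T := div_mul_cancel₀ T hv.ne'
  have hN : 0 < (S.card : ℝ) := by
    rw [Nat.cast_pos, Finset.card_pos, Finset.nonempty_iff_ne_empty]
    intro he
    simp only [hD, he] at h
    simp at h
    linarith
  have hblock : T < blockIndex pop (fun s => dir b (Z s).2) (inBall Z x r) g := by
    have hDpos : 0 < D := by nlinarith
    simp only [blockIndex, ← hS, ← hD]
    rw [max_eq_left hDpos.le, lt_div_iff₀ hN]
    calc T * S.card = 4 * (T / v) * (v / 4 * S.card) := by rw [← hTv']; field_simp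
      _ ≤ (T / v + v / 4 * S.card) ^ 2 := by nlinarith [sq_nonneg (T / v - v / 4 * S.card)]
      _ < D ^ 2 := by
        have : 0 ≤ v / 4 * S.card := by positivity
        exact pow_lt_pow_left₀ (by linarith) (by positivity) two_ne_zero
  exact hblock.trans_le (Finset.single_le_sum (f := fun g => blockIndex pop
    (fun s => dir b (Z s).2) (inBall Z x r) g) (fun g _ => blockIndex_nonneg _ _ _ _)
    (Finset.mem_univ g))

end

/-! ### Error probability at a fixed point -/

section

variable {d m nQ : ℕ} {nP : Fin m → ℕ}

lemma card_sampleIdx : Fintype.card (SampleIdx nQ nP) = totalSize nQ nP := by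
  simp [Fintype.card_sigma, Fintype.sum_option, sampleSize, totalSize]

lemma card_sampleIdx_filter (g : Option (Fin m)) :
    (Finset.univ.filter fun s : SampleIdx nQ nP => s.1 = g).card = sampleSize nQ nP g := by
  have : (Finset.univ.filter fun s : SampleIdx nQ nP => s.1 = g) =
      Finset.univ.map (Function.Embedding.sigmaMk g) := by
    ext ⟨g', i⟩
    simp only [Finset.mem_filter, Finset.mem_univ, true_and, Finset.mem_map,
      Function.Embedding.sigmaMk_apply]
    constructor
    · rintro rfl; exact ⟨i, rfl⟩
    · rintro ⟨a, ha⟩; exact (Sigma.mk.inj_iff.1 ha).1.symm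
  rw [this, Finset.card_map, Finset.card_univ, Fintype.card_fin]

lemma labelProb_not (b : Bool) (p : ℝ) : labelProb (!b) p = 1 - labelProb b p := by
  cases b <;> simp [labelProb]

/-- The threshold is at least `3 log n`: one power of `n` pays for the union over balls and two
remain. -/
lemma mul_exp_neg_threshold_le {n : ℕ} (hd : 1 ≤ d) (hn : 2 ≤ n) :
    (n : ℝ) * Real.exp (-threshold d n) ≤ ((n : ℝ) ^ 2)⁻¹ := by
  have hn0 : (0 : ℝ) < n := by positivity
  have h1 : Real.exp (-threshold d n) ≤ ((n : ℝ) ^ 3)⁻¹ := by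
    have hl : 0 ≤ Real.log n := Real.log_natCast_nonneg n
    rw [Real.exp_neg]
    refine inv_anti₀ (by positivity) ?_
    calc (n : ℝ) ^ 3 = Real.exp (3 * Real.log n) := by
          rw [← Real.exp_log (pow_pos hn0 3), Real.log_pow]; norm_num
      _ ≤ Real.exp (threshold d n) := by
          refine Real.exp_le_exp.2 (mul_le_mul_of_nonneg_right ?_ hl)
          have : (0 : ℝ) ≤ d := by positivity
          linarith
  calc (n : ℝ) * Real.exp (-threshold d n) ≤ n * ((n : ℝ) ^ 3)⁻¹ := by gcongr
    _ = ((n : ℝ) ^ 2)⁻¹ := by field_simp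

/-- The adaptive classifier returns the label `b` at `x` with high probability, if `b` is the more
likely label around `x` in each population and there is enough signal in some population. -/
lemma IsAdaptiveClassifier.measure_ne_le (hd : 1 ≤ d) (hn : 2 ≤ totalSize nQ nP)
    {f : Data d nQ nP → Feature d → Bool} (hf : IsAdaptiveClassifier f)
    {P : Fin m → Measure (Feature d × Bool)} {Q : Measure (Feature d × Bool)}
    [∀ i, IsProbabilityMeasure (P i)] [IsProbabilityMeasure Q]
    {ηP : Fin m → Feature d → ℝ} {ηQ : Feature d → ℝ}
    (hreg : ∀ g : Option (Fin m), IsRegressionFunction (g.elim Q P) (g.elim ηQ ηP))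
    (hac : ∀ g : Option (Fin m), marginal (g.elim Q P) ≪ volume)
    (x : Feature d) (b : Bool) (r : ℝ)
    (hgood : ∀ g : Option (Fin m), ∀ᵐ x' ∂(marginal (g.elim Q P)), ‖x' - x‖ ≤ r →
      1 / 2 ≤ labelProb b (g.elim ηQ ηP x'))
    (g : Option (Fin m)) {v p : ℝ} (hv0 : 0 < v) (hv : v ≤ 1 / 2)
    (hbias : ∀ᵐ x' ∂(marginal (g.elim Q P)), ‖x' - x‖ ≤ r →
      1 / 2 + v ≤ labelProb b (g.elim ηQ ηP x'))
    (hp : p ≤ (marginal (g.elim Q P)).real (Metric.closedBall x r))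
    (hlarge : 6 * threshold d (totalSize nQ nP) ≤ sampleSize nQ nP g * (p * v ^ 2)) :
    dataLaw P Q nQ nP {Z | f Z x ≠ b} ≤
      (expMomentBound ^ (m + 1) + 1) * ENNReal.ofReal (((totalSize nQ nP : ℝ) ^ 2)⁻¹) := by
  set n := totalSize nQ nP with hn'
  set T := threshold d n with hT
  have hT0 : 0 ≤ T := mul_nonneg (by positivity) (Real.log_natCast_nonneg n)
  let L : SampleIdx nQ nP → Measure (Feature d × Bool) := fun s => s.1.elim Q P
  have hL : ∀ s, IsProbabilityMeasure (L s) := by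
    rintro ⟨_ | i, j⟩
    · exact inferInstanceAs (IsProbabilityMeasure Q)
    · exact inferInstanceAs (IsProbabilityMeasure (P i))
  let η : SampleIdx nQ nP → Feature d → ℝ := fun s => s.1.elim ηQ ηP
  have hregL : ∀ s, IsRegressionFunction (L s) (η s) := fun s => hreg s.1
  -- Three bad events: a tie, a false alarm in a smaller ball, and too little evidence for `b` in
  -- the ball of radius `r`.
  have hE0 : Measure.pi L {Z | ¬ Function.Injective fun s => ‖(Z s).1 - x‖} = 0 :=
    ae_iff.1 (ae_injective_dist hd (L := L) (fun s => hac s.1) x)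
  have hE1 := measure_exists_signalIndex_gt_le (fun s : SampleIdx nQ nP => s.1) hregL (!b) T x r
    fun s => by
      filter_upwards [hgood s.1] with x' hx' hr
      rw [labelProb_not]; linarith [hx' hr]
  have hE2 := measure_sum_excessDir_le (fun s : SampleIdx nQ nP => s.1) hregL b g
    (measurableSet_closedBall (x := x) (ε := r)) hv0 hv
    (fun s hs => by
      subst hs
      filter_upwards [hbias] with x' hx' hr
      exact hx' (mem_closedBall_iff_norm.1 hr))
    (fun s hs => by subst hs; exact hp) T
  rw [card_sampleIdx_filter] at hE2
  rw [card_sampleIdx, Fintype.card_option, Fintype.card_fin] at hE1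
  have hn1 : (1 : ℝ) ≤ n := by exact_mod_cast (by omega : 1 ≤ n)
  have hrate : ENNReal.ofReal (n * Real.exp (-T)) ≤ ENNReal.ofReal (((n : ℝ) ^ 2)⁻¹) :=
    ENNReal.ofReal_le_ofReal (mul_exp_neg_threshold_le hd hn)
  have hsub : {Z | f Z x ≠ b} ⊆ {Z | ¬ Function.Injective fun s => ‖(Z s).1 - x‖} ∪
      ({Z | ∃ s₀, ‖(Z s₀).1 - x‖ ≤ r ∧ T < signalIndex (fun s : SampleIdx nQ nP => s.1)
        (fun s => dir (!b) (Z s).2) (inBall Z x ‖(Z s₀).1 - x‖)} ∪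
      {Z | ∑ s : SampleIdx nQ nP with s.1 = g,
        excessDir (Metric.closedBall x r) b v (Z s) ≤ T / v}) := by
    intro Z hZ
    by_contra hc
    simp only [Set.mem_union, Set.mem_ofPred_eq, not_or, not_not, not_exists, not_and, not_lt,
      not_le] at hc
    obtain ⟨hinj, h2, h3⟩ := hc
    obtain ⟨σ, hσ, hout⟩ := hf.output Z x
    exact hZ (hout.eq_of_signalIndex hσ hinj b r hT0
      (signalIndex_gt_of_sum_excessDir_gt _ b g Z x r hv0 hT0 h3) h2)
  calc dataLaw P Q nQ nP {Z | f Z x ≠ b}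
      ≤ Measure.pi L _ := measure_mono hsub
    _ ≤ 0 + (n * (expMomentBound ^ (m + 1) * ENNReal.ofReal (Real.exp (-T))) +
          ENNReal.ofReal (Real.exp (-T))) := by
        refine (measure_union_le _ _).trans (add_le_add hE0.le ((measure_union_le _ _).trans
          (add_le_add hE1 (hE2.trans (ENNReal.ofReal_le_ofReal (Real.exp_le_exp.2 ?_))))))
        -- The constant `6` in `hlarge` makes the exponent at most `2T - 3T = -T`.
        linarith
    _ ≤ (expMomentBound ^ (m + 1) + 1) * ENNReal.ofReal (n * Real.exp (-T)) := by
        rw [zero_add, add_mul, one_mul]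
        refine add_le_add (le_of_eq ?_) (ENNReal.ofReal_le_ofReal ?_)
        · rw [ENNReal.ofReal_mul (by positivity), ENNReal.ofReal_natCast]; ring
        · nlinarith [Real.exp_pos (-T)]
    _ ≤ _ := by gcongr

end

/-! ### Resolution, effective sample size and choice of radius -/

section

variable {d m nQ : ℕ} {nP : Fin m → ℕ}

/-- Above a multiple of the optimal resolution, some population carries enough signal. -/
lemma exists_signal_ge {G : Type*} [Fintype G] [Nonempty G] {β D c : ℝ} (hβ : 0 < β) (hD : 0 < D)
    (γ κ : G → ℝ) (hγ : ∀ g, 0 < γ g) (hκ : ∀ g, 0 < κ g) :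
    ∃ A : ℝ, 0 < A ∧ ∀ u : G → ℝ, (∀ g, 0 ≤ u g) →
      0 < ∑ g, u g ^ ((2 * β + D) / (2 * γ g * β + D)) → ∀ Δ : ℝ,
      A * (∑ g, u g ^ ((2 * β + D) / (2 * γ g * β + D))) ^ (-(β / (2 * β + D))) ≤ Δ →
      ∃ g, c ≤ u g * (κ g * Δ ^ ((D + 2 * γ g * β) / β)) := by
  have hq : ∀ g, 0 < (D + 2 * γ g * β) / β := fun g => by have := hγ g; positivity
  obtain ⟨A₀, hA₀, hA₀pos⟩ : ∃ A₀ : ℝ, (∀ g, c ≤ κ g * A₀ ^ ((D + 2 * γ g * β) / β)) ∧ 0 < A₀ := by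
    refine ((Filter.eventually_all.2 fun g => ?_).and (Filter.eventually_gt_atTop 0)).exists
    exact ((tendsto_rpow_atTop (hq g)).const_mul_atTop (hκ g)).eventually_ge_atTop c
  have hN : (0 : ℝ) < Fintype.card G := by exact_mod_cast Fintype.card_pos
  -- The power of `card G` compensates for replacing the sum by its average in the pigeonhole step.
  refine ⟨A₀ * (Fintype.card G : ℝ) ^ (β / (2 * β + D)), by positivity, fun u hu hS Δ hΔ => ?_⟩
  set S := ∑ g, u g ^ ((2 * β + D) / (2 * γ g * β + D)) with hSdef
  obtain ⟨g, hg⟩ : ∃ g, S / Fintype.card G ≤ u g ^ ((2 * β + D) / (2 * γ g * β + D)) := by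
    by_contra! hc
    have := Finset.sum_lt_sum_of_nonempty (Finset.univ_nonempty (α := G)) fun g _ => hc g
    rw [Finset.sum_const, Finset.card_univ, nsmul_eq_mul, mul_div_cancel₀ _ hN.ne'] at this
    exact lt_irrefl _ this
  have hγg := hγ g
  have he : 0 < (2 * β + D) / (2 * γ g * β + D) := by positivity
  have hSN : 0 < S / Fintype.card G := by positivity
  have hug : 0 < u g := by
    refine lt_of_le_of_ne (hu g) fun h0 => ?_
    rw [← h0, Real.zero_rpow he.ne'] at hg
    linarith
  have h1 : A₀ * u g ^ (-(β / (2 * γ g * β + D))) ≤ Δ := by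
    refine le_trans ?_ hΔ
    have h2 : (u g ^ ((2 * β + D) / (2 * γ g * β + D))) ^ (-(β / (2 * β + D))) ≤
        (S / Fintype.card G) ^ (-(β / (2 * β + D))) :=
      Real.rpow_le_rpow_of_nonpos hSN hg (by rw [neg_nonpos]; positivity)
    rw [← Real.rpow_mul hug.le, Real.div_rpow hS.le hN.le, Real.rpow_neg hN.le, div_inv_eq_mul] at h2
    -- The exponents in the effective size are such that each term, raised to the power of the
    -- overall rate, gives the resolution of that population alone.
    have h3 : (2 * β + D) / (2 * γ g * β + D) * -(β / (2 * β + D)) =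
        -(β / (2 * γ g * β + D)) := by field_simp
    rw [h3] at h2
    calc _ ≤ A₀ * (S ^ (-(β / (2 * β + D))) * (Fintype.card G : ℝ) ^ (β / (2 * β + D))) := by gcongr
      _ = _ := by ring
  refine ⟨g, (hA₀ g).trans ?_⟩
  have h4 : (A₀ * u g ^ (-(β / (2 * γ g * β + D)))) ^ ((D + 2 * γ g * β) / β) ≤
      Δ ^ ((D + 2 * γ g * β) / β) := Real.rpow_le_rpow (by positivity) h1 (hq g).le
  rw [Real.mul_rpow hA₀pos.le (by positivity), ← Real.rpow_mul hug.le] at h4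
  -- At its own resolution the signal of `g` is inversely proportional to `u g`, so `u g` cancels
  -- and a constant is left.
  have h5 : -(β / (2 * γ g * β + D)) * ((D + 2 * γ g * β) / β) = -1 := by
    have : 2 * γ g * β + D ≠ 0 := by positivity
    rw [add_comm D]; field_simp
  rw [h5, Real.rpow_neg_one] at h4
  calc κ g * A₀ ^ ((D + 2 * γ g * β) / β)
      = u g * (κ g * (A₀ ^ ((D + 2 * γ g * β) / β) * (u g)⁻¹)) := by field_simp
    _ ≤ _ := by have := (hκ g).le; gcongr

lemma DensityBounds.le_measure {ν : Measure (Feature d)} [IsFiniteMeasure ν] {μlo μhi : ℝ}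
    (h : DensityBounds ν μlo μhi) (B : Set (Feature d)) :
    ENNReal.ofReal μlo * volume (ν.support ∩ B) ≤ ν B := by
  have hs : MeasurableSet ν.support := Measure.isClosed_support.measurableSet
  calc ENNReal.ofReal μlo * volume (ν.support ∩ B)
      = ∫⁻ _ in ν.support ∩ B, ENNReal.ofReal μlo := by rw [setLIntegral_const]
    _ ≤ ∫⁻ x in ν.support ∩ B, ν.rnDeriv volume x := by
        refine lintegral_mono_ae ?_
        filter_upwards [ae_restrict_of_ae_restrict_of_subset Set.inter_subset_left h.2] with x hx
          using hx.1.le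
    _ = ν (ν.support ∩ B) := Measure.setLIntegral_rnDeriv h.1 _
    _ ≤ ν B := measure_mono Set.inter_subset_right

lemma StrongDensity.closedBall_le {νP νQ : Measure (Feature d)} {μlo μhi cμ rμ : ℝ}
    (hμlo : 0 ≤ μlo) (hcμ : 0 ≤ cμ) (h : StrongDensity νP νQ μlo μhi cμ rμ)
    {ν : Measure (Feature d)} [IsFiniteMeasure ν] (hν : ν.support = νQ.support)
    (hb : DensityBounds ν μlo μhi) {x : Feature d} (hx : x ∈ νQ.support) {r : ℝ} (hr : 0 < r)
    (hrμ : r ≤ rμ) :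
    μlo * cμ * volume.real (Metric.ball (0 : Feature d) 1) * r ^ d ≤
      ν.real (Metric.closedBall x r) := by
  have h1 := hb.le_measure (Metric.closedBall x r)
  rw [hν] at h1
  have h2 : ENNReal.ofReal μlo * (ENNReal.ofReal cμ * volume (Metric.closedBall x r)) ≤
      ν (Metric.closedBall x r) := (mul_le_mul_right (h.2.2.2 x hx r hr hrμ) _).trans h1
  have h3 := ENNReal.toReal_mono (measure_ne_top _ _) h2
  rw [ENNReal.toReal_mul, ENNReal.toReal_mul, ENNReal.toReal_ofReal hμlo,
    ENNReal.toReal_ofReal hcμ, Measure.addHaar_closedBall _ _ hr.le, ENNReal.toReal_mul,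
    ENNReal.toReal_ofReal (by positivity), finrank_euclideanSpace_fin] at h3
  refine le_trans (le_of_eq ?_) h3
  rw [measureReal_def]; ring

/-- The effective sample size. -/
def effSize (β : ℝ) (γ : Fin m → ℝ) (d nQ : ℕ) (nP : Fin m → ℕ) : ℝ :=
  (nQ : ℝ) / Real.log (totalSize nQ nP) +
    ∑ i, ((nP i : ℝ) / Real.log (totalSize nQ nP)) ^ ((2 * β + d) / (2 * γ i * β + d))

/-- The relative signal exponents and constants of all populations. -/
abbrev withTarget (γ : Fin m → ℝ) (g : Option (Fin m)) : ℝ := g.elim 1 γ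

lemma withTarget_pos {γ : Fin m → ℝ} (hγ : ∀ i, 0 < γ i) (g : Option (Fin m)) :
    0 < withTarget γ g := by
  cases g
  · exact one_pos
  · exact hγ _

/-- The target enters as one more population with relative exponent `1`, whose power in the sum is
then `1`. -/
lemma effSize_eq {β : ℝ} (hβ : 0 < β) (γ : Fin m → ℝ) (d nQ : ℕ) (nP : Fin m → ℕ) :
    effSize β γ d nQ nP = ∑ g : Option (Fin m),
      ((sampleSize nQ nP g : ℝ) / Real.log (totalSize nQ nP)) ^
        ((2 * β + d) / (2 * withTarget γ g * β + d)) := by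
  rw [Fintype.sum_option, effSize]
  have : (2 * β + (d : ℝ)) / (2 * withTarget γ none * β + d) = 1 := by
    simp only [withTarget, Option.elim, mul_one]; exact div_self (by positivity)
  rw [this, Real.rpow_one]; rfl

lemma effSize_pos {β : ℝ} (hβ : 0 < β) {γ : Fin m → ℝ} {d nQ : ℕ}
    {nP : Fin m → ℕ} (hn : 2 ≤ totalSize nQ nP) : 0 < effSize β γ d nQ nP := by
  have hl : 0 < Real.log (totalSize nQ nP) := Real.log_pos (by exact_mod_cast hn)
  rw [effSize_eq hβ]
  obtain ⟨s⟩ : Nonempty (SampleIdx nQ nP) := by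
    rw [← Fintype.card_pos_iff, card_sampleIdx]; omega
  refine Finset.sum_pos' (fun g _ => by positivity) ⟨s.1, Finset.mem_univ _, ?_⟩
  have : (0 : ℝ) < sampleSize nQ nP s.1 := by exact_mod_cast (Nat.zero_le _).trans_lt s.2.2
  positivity

lemma labelProb_eq_add_abs {η ηx : ℝ} {b : Bool} (hb : b = true ↔ 1 / 2 < ηx)
    (h : 0 ≤ (η - 1 / 2) * (ηx - 1 / 2)) (hne : ηx ≠ 1 / 2) :
    labelProb b η = 1 / 2 + |η - 1 / 2| := by
  cases b
  · have hlt : ηx < 1 / 2 := lt_of_le_of_ne (not_lt.1 fun hc => Bool.false_ne_true (hb.2 hc)) hne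
    have : η - 1 / 2 ≤ 0 := by nlinarith
    rw [abs_of_nonpos this]; simp [labelProb]; ring
  · have hlt := hb.1 rfl
    have : 0 ≤ η - 1 / 2 := by nlinarith
    rw [abs_of_nonneg this]; simp [labelProb]

/-- The adaptive classifier agrees with the Bayes classifier with high probability at each point
where the regression function is away from `1/2`. -/
lemma exists_measure_ne_bayes_le (hd : 1 ≤ d) (hm : 1 ≤ m) {α Cα β Cβ : ℝ} {γ Cγ : Fin m → ℝ}
    {μlo μhi cμ rμ : ℝ} (hβ : 0 < β) (hCβ : 0 < Cβ) (hγ : ∀ i, 0 < γ i) (hCγ : ∀ i, 0 < Cγ i)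
    (hμlo : 0 < μlo) (hcμ : 0 < cμ) (hrμ : 0 < rμ) :
    ∃ A : ℝ, 0 < A ∧ ∀ (nQ : ℕ) (nP : Fin m → ℕ), 2 ≤ totalSize nQ nP →
      ∀ f : Data d nQ nP → Feature d → Bool, IsAdaptiveClassifier f →
      ∀ (P : Fin m → Measure (Feature d × Bool)) (Q : Measure (Feature d × Bool))
        (ηP : Fin m → Feature d → ℝ) (ηQ : Feature d → ℝ),
        MemClass α Cα β Cβ γ Cγ μlo μhi cμ rμ P Q ηP ηQ →
      ∀ x ∈ (marginal Q).support, A * effSize β γ d nQ nP ^ (-(β / (2 * β + d))) ≤ |ηQ x - 1 / 2| →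
        dataLaw P Q nQ nP {Z | f Z x ≠ bayes ηQ x} ≤
          (expMomentBound ^ (m + 1) + 1) * ENNReal.ofReal (((totalSize nQ nP : ℝ) ^ 2)⁻¹) := by
  have hd' : (0 : ℝ) < d := by exact_mod_cast hd
  set V := volume.real (Metric.ball (0 : Feature d) 1) with hV
  have hVpos : 0 < V := ENNReal.toReal_pos (Metric.measure_ball_pos _ _ one_pos).ne'
    measure_ball_lt_top.ne
  -- The two bounds ensure `r ≤ rμ` (as `Δ ≤ 1`) and `Cβ r^β ≤ Δ/2` for `r = c₁ Δ^(1/β)`.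
  set c₁ := min rμ ((1 / (2 * Cβ)) ^ (1 / β)) with hc₁
  have hc₁pos : 0 < c₁ := lt_min hrμ (by positivity)
  -- The constant in `p v² = κ g Δ^((d + 2γβ)/β)`, where `p` is the lower bound for the mass of the
  -- ball of radius `r` and `v` the bias in it. The value `c = 6(d+3)` below matches six times the
  -- threshold.
  let κ : Option (Fin m) → ℝ := fun g => μlo * cμ * V * c₁ ^ d *
    (withTarget Cγ g * (1 / 2) ^ withTarget γ g) ^ 2
  have hκ : ∀ g, 0 < κ g := fun g => by
    have := withTarget_pos hCγ g
    positivity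
  obtain ⟨A, hA, hmain⟩ := exists_signal_ge (c := 6 * ((d : ℝ) + 3)) hβ hd' (withTarget γ) κ
    (withTarget_pos hγ) hκ
  refine ⟨A, hA, fun nQ nP hn f hf P Q ηP ηQ hmem x hx hΔ => ?_⟩
  have := hmem.probP
  have := hmem.probQ
  have hl : 0 < Real.log (totalSize nQ nP) := Real.log_pos (by exact_mod_cast hn)
  have hS := effSize_pos hβ (γ := γ) (d := d) hn
  set Δ := |ηQ x - 1 / 2| with hΔdef
  have hΔpos : 0 < Δ := lt_of_lt_of_le (by positivity) hΔ
  have hΔ1 : Δ ≤ 1 := abs_le.2 ⟨by linarith [(hmem.regQ.mem_Icc x).1],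
    by linarith [(hmem.regQ.mem_Icc x).2]⟩
  have hne : ηQ x ≠ 1 / 2 := fun h => by simp [hΔdef, h] at hΔpos
  rw [effSize_eq hβ] at hΔ hS
  obtain ⟨g, hg⟩ := hmain (fun g => (sampleSize nQ nP g : ℝ) / Real.log (totalSize nQ nP))
    (fun g => by positivity) hS Δ hΔ
  set r := c₁ * Δ ^ (1 / β) with hr
  have hrpos : 0 < r := by positivity
  have hΔr1 : Δ ^ (1 / β) ≤ 1 := Real.rpow_le_one hΔpos.le hΔ1 (by positivity)
  have hr_le : r ≤ rμ := (mul_le_of_le_one_right hc₁pos.le hΔr1).trans (min_le_left _ _)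
  have hrβ : Cβ * r ^ β ≤ Δ / 2 := by
    have h1 : c₁ ^ β ≤ 1 / (2 * Cβ) := by
      calc c₁ ^ β ≤ ((1 / (2 * Cβ)) ^ (1 / β)) ^ β :=
            Real.rpow_le_rpow hc₁pos.le (min_le_right _ _) hβ.le
        _ = _ := by rw [← Real.rpow_mul (by positivity), one_div_mul_cancel hβ.ne', Real.rpow_one]
    have h2 : (Δ ^ (1 / β)) ^ β = Δ := by
      rw [← Real.rpow_mul hΔpos.le, one_div_mul_cancel hβ.ne', Real.rpow_one]
    rw [hr, Real.mul_rpow hc₁pos.le (by positivity), h2]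
    calc Cβ * (c₁ ^ β * Δ) ≤ Cβ * (1 / (2 * Cβ) * Δ) := by gcongr
      _ = Δ / 2 := by field_simp
  -- The density conditions on the target are stated jointly with a source, so one source is needed
  -- to read them off.
  let i₀ : Fin m := ⟨0, hm⟩
  have hsupp : ∀ g : Option (Fin m), (marginal (g.elim Q P)).support = (marginal Q).support := by
    rintro (_ | i)
    · rfl
    · exact (hmem.density i).1
  have hdens : ∀ g : Option (Fin m), DensityBounds (marginal (g.elim Q P)) μlo μhi := by
    rintro (_ | i)
    · exact (hmem.density i₀).2.2.1
    · exact (hmem.density i).2.1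
  have hreg : ∀ g : Option (Fin m), IsRegressionFunction (g.elim Q P) (g.elim ηQ ηP) := by
    rintro (_ | i)
    · exact hmem.regQ
    · exact hmem.regP i
  have hprob : ∀ g : Option (Fin m), IsProbabilityMeasure (g.elim Q P) := by
    rintro (_ | i)
    · exact hmem.probQ
    · exact hmem.probP i
  set b := bayes ηQ x with hb
  have hbiff : b = true ↔ 1 / 2 < ηQ x := by
    rw [hb, bayes]; split_ifs with h
    · simpa using h
    · simpa using h
  have hbiasQ : ∀ x' ∈ (marginal Q).support, ‖x' - x‖ ≤ r →
      0 ≤ (ηQ x' - 1 / 2) * (ηQ x - 1 / 2) ∧ Δ / 2 ≤ |ηQ x' - 1 / 2| := by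
    intro x' hx' hxr
    have h1 : |ηQ x' - ηQ x| ≤ Δ / 2 := (hmem.smooth x' hx' x hx).trans (le_trans
      (mul_le_mul_of_nonneg_left (Real.rpow_le_rpow (norm_nonneg _) hxr hβ.le) hCβ.le) hrβ)
    obtain ⟨h2, h3⟩ := abs_le.1 h1
    rcases le_total 0 (ηQ x - 1 / 2) with h | h
    · rw [abs_of_nonneg h] at hΔdef
      have : 0 ≤ ηQ x' - 1 / 2 := by linarith
      exact ⟨mul_nonneg this h, by rw [abs_of_nonneg this]; linarith⟩
    · rw [abs_of_nonpos h] at hΔdef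
      have : ηQ x' - 1 / 2 ≤ 0 := by linarith
      exact ⟨mul_nonneg_of_nonpos_of_nonpos this h, by rw [abs_of_nonpos this]; linarith⟩
  have hbias : ∀ g : Option (Fin m), ∀ x' ∈ (marginal Q).support, ‖x' - x‖ ≤ r →
      1 / 2 + withTarget Cγ g * (Δ / 2) ^ withTarget γ g ≤ labelProb b (g.elim ηQ ηP x') := by
    intro g x' hx' hxr
    obtain ⟨h1, h2⟩ := hbiasQ x' hx' hxr
    cases g with
    | none =>
      simp only [withTarget, Option.elim]
      rw [labelProb_eq_add_abs hbiff h1 hne, Real.rpow_one, one_mul]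
      linarith
    | some i =>
      simp only [withTarget, Option.elim]
      obtain ⟨h3, h4⟩ := hmem.signal i x' (Or.inr hx')
      -- Sign agreement is chained through `ηQ x'`, which is possible because `ηQ x' ≠ 1/2`.
      have h5 : 0 ≤ (ηP i x' - 1 / 2) * (ηQ x - 1 / 2) := by
        have hpos : 0 < |ηQ x' - 1 / 2| := by linarith
        have h6 : 0 ≤ ((ηP i x' - 1 / 2) * (ηQ x' - 1 / 2)) *
            ((ηQ x' - 1 / 2) * (ηQ x - 1 / 2)) := mul_nonneg h3 h1
        have h7 : ((ηP i x' - 1 / 2) * (ηQ x' - 1 / 2)) * ((ηQ x' - 1 / 2) * (ηQ x - 1 / 2)) =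
            ((ηP i x' - 1 / 2) * (ηQ x - 1 / 2)) * |ηQ x' - 1 / 2| ^ 2 := by
          rw [sq_abs]; ring
        rw [h7] at h6
        exact nonneg_of_mul_nonneg_left h6 (by positivity)
      rw [labelProb_eq_add_abs hbiff h5 hne]
      have h8 : (Δ / 2) ^ γ i ≤ |ηQ x' - 1 / 2| ^ γ i :=
        Real.rpow_le_rpow (by positivity) h2 (hγ i).le
      have h9 := mul_le_mul_of_nonneg_left h8 (hCγ i).le
      linarith
  have hae : ∀ g : Option (Fin m), ∀ᵐ x' ∂(marginal (g.elim Q P)), x' ∈ (marginal Q).support :=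
    fun g => by rw [← hsupp g]; exact Measure.support_mem_ae
  set v := withTarget Cγ g * (Δ / 2) ^ withTarget γ g with hv
  have hCg := withTarget_pos hCγ g
  have hvpos : 0 < v := by positivity
  refine hf.measure_ne_le hd hn hreg (fun g => (hdens g).1) x b r (fun g' => ?_) g (v := v)
    (p := μlo * cμ * V * r ^ d) hvpos ?_ ?_ ?_ ?_
  · filter_upwards [hae g'] with x' hx' hxr
    have h1 := hbias g' x' hx' hxr
    have h2 : 0 < withTarget Cγ g' * (Δ / 2) ^ withTarget γ g' := by
      have := withTarget_pos hCγ g'; positivity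
    linarith
  -- The bound `v ≤ 1/2` holds because `1/2 + v` lies below a probability, namely that of `b` at `x`
  -- itself.
  · have h1 := hbias g x hx (by simpa using hrpos.le)
    have h2 : labelProb b (g.elim ηQ ηP x) ≤ 1 := by
      have := (hreg g).mem_Icc x
      cases b
      · simp only [labelProb, Bool.false_eq_true, if_false]; linarith [this.1]
      · simpa [labelProb] using this.2
    linarith
  · filter_upwards [hae g] with x' hx' hxr using hbias g x' hx' hxr
  · exact (hmem.density i₀).closedBall_le hμlo.le hcμ.le (hsupp g) (hdens g) hx hrpos hr_le
  · have h1 : μlo * cμ * V * r ^ d * v ^ 2 =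
        κ g * Δ ^ (((d : ℝ) + 2 * withTarget γ g * β) / β) := by
      have h2 : (Δ ^ (1 / β)) ^ d = Δ ^ ((d : ℝ) / β) := by
        rw [← Real.rpow_natCast, ← Real.rpow_mul hΔpos.le]; congr 1; ring
      have h3 : (Δ ^ withTarget γ g) ^ 2 = Δ ^ (2 * withTarget γ g) := by
        rw [← Real.rpow_natCast, ← Real.rpow_mul hΔpos.le]; congr 1; push_cast; ring
      have h4 : ((d : ℝ) + 2 * withTarget γ g * β) / β = (d : ℝ) / β + 2 * withTarget γ g := by
        field_simp
      have h5 : (Δ / 2) ^ withTarget γ g = Δ ^ withTarget γ g * (1 / 2) ^ withTarget γ g := by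
        rw [← Real.mul_rpow hΔpos.le (by norm_num)]; congr 1; ring
      rw [h4, Real.rpow_add hΔpos, ← h2, ← h3, hv, hr, h5]
      ring
    rw [h1, threshold, ← mul_assoc]
    have h6 := mul_le_mul_of_nonneg_right hg hl.le
    refine h6.trans (le_of_eq ?_)
    field_simp

end

/-! ### From pointwise error to excess risk -/

section

variable {d m nQ : ℕ} {nP : Fin m → ℕ}

lemma measurable_bayes {η : Feature d → ℝ} (hη : Measurable η) : Measurable (bayes η) :=
  Measurable.ite (measurableSet_le hη measurable_const) measurable_const measurable_const

lemma IsRegressionFunction.risk_eq {Q : Measure (Feature d × Bool)} [IsProbabilityMeasure Q]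
    {η : Feature d → ℝ} (h : IsRegressionFunction Q η) {f : Feature d → Bool}
    (hf : Measurable f) :
    risk Q f = ∫ x, labelProb (!f x) (η x) ∂(marginal Q) := by
  have hE : MeasurableSet {z : Feature d × Bool | f z.1 ≠ z.2} :=
    (measurableSet_eq_fun (hf.comp measurable_fst) measurable_snd).compl
  have hnn : ∀ x, 0 ≤ labelProb (!f x) (η x) := fun x => by
    have := h.mem_Icc x
    cases f x
    · simpa [labelProb] using this.1
    · simpa [labelProb] using this.2
  have hm : Measurable fun x => labelProb (!f x) (η x) := by
    have : (fun x => labelProb (!f x) (η x)) = fun x => if f x = true then 1 - η x else η x := by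
      funext x; cases f x <;> simp [labelProb]
    rw [this]
    exact Measurable.ite (hf (measurableSet_singleton true)) (h.measurable.const_sub 1) h.measurable
  rw [risk, measureReal_def, ← lintegral_indicator_one hE,
    h.lintegral_eq (measurable_one.indicator hE),
    integral_eq_lintegral_of_nonneg_ae (Filter.Eventually.of_forall hnn) hm.aestronglyMeasurable]
  congr 1
  refine lintegral_congr fun x => ?_
  cases hx : f x <;> simp [labelProb, hx]

lemma labelProb_sub_bayes (η : Feature d → ℝ) (x : Feature d) (y : Bool) :
    labelProb (!y) (η x) - labelProb (!bayes η x) (η x) =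
      if y ≠ bayes η x then 2 * |η x - 1 / 2| else 0 := by
  by_cases h : η x ≤ 1 / 2
  · have hb : bayes η x = false := if_pos h
    rw [hb, abs_of_nonpos (by linarith)]
    cases y
    · simp
    · simp only [labelProb]; simp; ring
  · have hb : bayes η x = true := if_neg h
    rw [hb, abs_of_pos (by linarith)]
    cases y
    · simp only [labelProb]; simp; ring
    · simp

lemma IsRegressionFunction.integrable_labelProb {Q : Measure (Feature d × Bool)}
    [IsProbabilityMeasure Q] {η : Feature d → ℝ} (h : IsRegressionFunction Q η)
    {f : Feature d → Bool} (hf : Measurable f) :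
    Integrable (fun x => labelProb (!f x) (η x)) (marginal Q) := by
  have : (fun x => labelProb (!f x) (η x)) = fun x => if f x = true then 1 - η x else η x := by
    funext x; cases f x <;> simp [labelProb]
  rw [this]
  refine Integrable.of_mem_Icc 0 1 (Measurable.ite (hf (measurableSet_singleton true))
    (h.measurable.const_sub 1) h.measurable).aemeasurable (Filter.Eventually.of_forall fun x => ?_)
  have := h.mem_Icc x
  split_ifs
  · exact ⟨by linarith [this.2], by linarith [this.1]⟩
  · exact this

/-- The excess risk is the mean of `2 |η - 1/2|` over the points of disagreement with the Bayes
classifier. -/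
lemma IsRegressionFunction.excessRisk_eq {Q : Measure (Feature d × Bool)}
    [IsProbabilityMeasure Q] {η : Feature d → ℝ} (h : IsRegressionFunction Q η)
    {f : Feature d → Bool} (hf : Measurable f) :
    excessRisk Q η f =
      ∫ x, (if f x ≠ bayes η x then 2 * |η x - 1 / 2| else 0) ∂(marginal Q) := by
  have hb := measurable_bayes h.measurable
  rw [excessRisk, h.risk_eq hf, h.risk_eq hb,
    ← integral_sub (h.integrable_labelProb hf) (h.integrable_labelProb hb)]
  exact integral_congr_ae (Filter.Eventually.of_forall fun x => labelProb_sub_bayes η x (f x))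

/-- The expected excess risk of a classifier that disagrees with the Bayes classifier with
probability at most `ε` wherever the regression function has distance at least `τ` to `1/2`. -/
lemma integral_excessRisk_le {Ω : Type*} [MeasurableSpace Ω] {μ : Measure Ω}
    [IsProbabilityMeasure μ] {Q : Measure (Feature d × Bool)} [IsProbabilityMeasure Q]
    {η : Feature d → ℝ} (h : IsRegressionFunction Q η) {α Cα : ℝ} (hmargin : MarginAssumption Q η α Cα)
    (hCα : 0 ≤ Cα) {f : Ω → Feature d → Bool} (hf : Measurable (Function.uncurry f))
    {τ ε : ℝ} (hτ : 0 < τ) (hε : 0 ≤ ε)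
    (hfar : ∀ x ∈ (marginal Q).support, τ ≤ |η x - 1 / 2| → μ.real {ω | f ω x ≠ bayes η x} ≤ ε) :
    Integrable (fun ω => excessRisk Q η (f ω)) μ ∧
      ∫ ω, excessRisk Q η (f ω) ∂μ ≤ 2 * τ * (Cα * τ ^ α) + ε := by
  have hη := h.measurable
  have hb := measurable_bayes hη
  have habs : ∀ x, 2 * |η x - 1 / 2| ≤ 1 := fun x => by
    have := h.mem_Icc x
    have : |η x - 1 / 2| ≤ 1 / 2 := abs_le.2 ⟨by linarith [this.1], by linarith [this.2]⟩
    linarith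
  have hD : MeasurableSet {z : Ω × Feature d | f z.1 z.2 ≠ bayes η z.2} :=
    (measurableSet_eq_fun hf (hb.comp measurable_snd)).compl
  set H : Ω → Feature d → ℝ := fun ω x =>
    if f ω x ≠ bayes η x then 2 * |η x - 1 / 2| else 0 with hH
  have hHm : Measurable (Function.uncurry H) :=
    Measurable.ite hD (by fun_prop) measurable_const
  have hHint : Integrable (Function.uncurry H) (μ.prod (marginal Q)) := by
    refine Integrable.of_mem_Icc 0 1 hHm.aemeasurable (Filter.Eventually.of_forall fun z => ?_)
    simp only [Function.uncurry, hH]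
    split_ifs
    · exact ⟨by positivity, habs _⟩
    · simp
  have heq : ∀ ω, excessRisk Q η (f ω) = ∫ x, H ω x ∂(marginal Q) := fun ω =>
    h.excessRisk_eq (hf.comp measurable_prodMk_left)
  simp only [heq]
  refine ⟨hHint.integral_prod_left, ?_⟩
  rw [integral_integral_swap hHint]
  have hinner : ∀ x, ∫ ω, H ω x ∂μ = 2 * |η x - 1 / 2| * μ.real {ω | f ω x ≠ bayes η x} := by
    intro x
    have hm : MeasurableSet {ω | f ω x ≠ bayes η x} := measurable_prodMk_right hD
    have : (fun ω => H ω x) = {ω | f ω x ≠ bayes η x}.indicator fun _ => 2 * |η x - 1 / 2| := by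
      funext ω; simp only [hH, Set.indicator_apply]; rfl
    rw [this, integral_indicator_const _ hm, smul_eq_mul, mul_comm]
  have hnear : MeasurableSet {x | |η x - 1 / 2| < τ} :=
    measurableSet_lt (by fun_prop) measurable_const
  have hint : Integrable (fun x => {x | |η x - 1 / 2| < τ}.indicator (fun _ => 2 * τ) x + ε)
      (marginal Q) := ((integrable_const _).indicator hnear).add (integrable_const _)
  -- Near the decision boundary the loss is at most `2τ` with the trivial probability bound; away
  -- from it the loss is at most `1` with probability bound `ε`.
  have hpt : ∀ᵐ x ∂(marginal Q), ∫ ω, H ω x ∂μ ≤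
      {x | |η x - 1 / 2| < τ}.indicator (fun _ => 2 * τ) x + ε := by
    filter_upwards [Measure.support_mem_ae (μ := marginal Q)] with x hx
    rw [hinner x]
    by_cases hxτ : |η x - 1 / 2| < τ
    · rw [Set.indicator_of_mem (by exact hxτ)]
      have := measureReal_le_one (μ := μ) (s := {ω | f ω x ≠ bayes η x})
      calc _ ≤ 2 * |η x - 1 / 2| * 1 := by gcongr
        _ ≤ 2 * τ + ε := by linarith
    · rw [Set.indicator_of_notMem (by exact hxτ), zero_add]
      calc _ ≤ 1 * ε := mul_le_mul (habs x) (hfar x hx (not_lt.1 hxτ)) measureReal_nonneg one_pos.le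
        _ = ε := one_mul ε
  refine (integral_mono_ae hHint.integral_prod_right hint hpt).trans ?_
  rw [integral_add ((integrable_const _).indicator hnear) (integrable_const _),
    integral_indicator_const _ hnear, integral_const, probReal_univ, one_smul, smul_eq_mul]
  have h1 : (marginal Q).real {x | |η x - 1 / 2| < τ} ≤ Cα * τ ^ α :=
    ENNReal.toReal_le_of_le_ofReal (by positivity) (hmargin τ hτ)
  nlinarith

/-- Makes the `n^(-2)` failure probability negligible. Each exponent in the effective size is at
most `(2β+d)/d`, so raising that size to the rate gives at most a constant times `(2n)^(β(1+α)/d)`,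
and `β + αβ ≤ 1 + d ≤ 2d`. -/
lemma inv_sq_le_effSize_rpow {α β : ℝ} {γ : Fin m → ℝ} (hd : 1 ≤ d) (hα : 0 ≤ α) (hβ : 0 < β)
    (hβ1 : β ≤ 1) (hγ : ∀ i, 0 < γ i) (hαβ : α * β ≤ d) (hn : 2 ≤ totalSize nQ nP) :
    ((totalSize nQ nP : ℝ) ^ 2)⁻¹ ≤ 4 * ((m : ℝ) + 1) ^ (β * (1 + α) / (2 * β + d)) *
      effSize β γ d nQ nP ^ (-(β * (1 + α) / (2 * β + d))) := by
  have hd' : (1 : ℝ) ≤ d := by exact_mod_cast hd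
  set n := totalSize nQ nP with hn'
  have hn2 : (2 : ℝ) ≤ n := by exact_mod_cast hn
  -- Bounds `n_g / log n` by `2n`, a base above `1` whose exponent may be increased.
  have hl : 1 / 2 ≤ Real.log n := by
    have := Real.log_two_gt_d9
    have := Real.log_le_log (by norm_num) hn2
    linarith
  have hS := effSize_pos hβ (γ := γ) (d := d) hn
  set D := (2 * β + (d : ℝ)) / d with hD
  set θ := β * (1 + α) / (2 * β + d) with hθ
  have hθ0 : 0 ≤ θ := by positivity
  have hupper : effSize β γ d nQ nP ≤ (m + 1) * (2 * n : ℝ) ^ D := by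
    rw [effSize_eq hβ]
    have : ∀ g ∈ (Finset.univ : Finset (Option (Fin m))),
        ((sampleSize nQ nP g : ℝ) / Real.log n) ^ ((2 * β + d) / (2 * withTarget γ g * β + d)) ≤
          (2 * n : ℝ) ^ D := by
      intro g _
      have hg := withTarget_pos hγ g
      have h1 : (sampleSize nQ nP g : ℝ) ≤ n := by
        have : sampleSize nQ nP g ≤ n := by
          rw [← card_sampleIdx_filter, hn', ← card_sampleIdx]; exact Finset.card_le_univ _
        exact_mod_cast this
      have h2 : (sampleSize nQ nP g : ℝ) / Real.log n ≤ 2 * n := by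
        rw [div_le_iff₀ (by linarith)]; nlinarith
      calc _ ≤ (2 * n : ℝ) ^ ((2 * β + d) / (2 * withTarget γ g * β + d)) :=
            Real.rpow_le_rpow (by positivity) h2 (by positivity)
        _ ≤ _ := by
            refine Real.rpow_le_rpow_of_exponent_le (by linarith) ?_
            refine div_le_div_of_nonneg_left (by positivity) (by positivity) ?_
            have : 0 ≤ 2 * withTarget γ g * β := by positivity
            linarith
    refine (Finset.sum_le_card_nsmul _ _ _ this).trans (le_of_eq ?_)
    rw [Finset.card_univ, Fintype.card_option, Fintype.card_fin, nsmul_eq_mul]; push_cast; ring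
  have hDθ : D * θ ≤ 2 := by
    have : D * θ = β * (1 + α) / d := by
      rw [hD, hθ]; field_simp
    rw [this, div_le_iff₀ (by linarith)]; nlinarith
  have h2n : (0 : ℝ) ≤ 2 * n := by positivity
  have hpow : effSize β γ d nQ nP ^ θ ≤ 4 * ((m : ℝ) + 1) ^ θ * (n : ℝ) ^ 2 := by
    calc _ ≤ ((m + 1) * (2 * n : ℝ) ^ D) ^ θ := Real.rpow_le_rpow hS.le hupper hθ0
      _ = ((m : ℝ) + 1) ^ θ * (2 * n : ℝ) ^ (D * θ) := by
          rw [Real.mul_rpow (by positivity) (by positivity), ← Real.rpow_mul h2n]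
      _ ≤ ((m : ℝ) + 1) ^ θ * (2 * n : ℝ) ^ (2 : ℝ) := by
          gcongr
          linarith
      _ = _ := by rw [Real.rpow_two]; ring
  have hSθ : 0 < effSize β γ d nQ nP ^ θ := by positivity
  rw [Real.rpow_neg hS.le, inv_le_iff_one_le_mul₀ (by positivity)]
  rw [show 4 * ((m : ℝ) + 1) ^ θ * (effSize β γ d nQ nP ^ θ)⁻¹ * (n : ℝ) ^ 2 =
    (4 * ((m : ℝ) + 1) ^ θ * (n : ℝ) ^ 2) / effSize β γ d nQ nP ^ θ by ring]
  rwa [one_le_div hSθ]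

end

end PosteriorDrift

end

/-! ### The convergence rate -/

open PosteriorDrift
theorem theorem6 (d m : ℕ) (hd : 1 ≤ d) (hm : 1 ≤ m)
    (α Cα β Cβ : ℝ) (γ Cγ : Fin m → ℝ) (μlo μhi cμ rμ : ℝ)
    (hα : 0 ≤ α) (hCα : 0 < Cα) (hβ : 0 < β) (hβ1 : β ≤ 1) (hCβ : 0 < Cβ)
    (hγ : ∀ i, 0 < γ i) (hCγ : ∀ i, 0 < Cγ i)
    (hμlo : 0 < μlo) (hμ : μlo < μhi) (hcμ : 0 < cμ) (hrμ : 0 < rμ)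
    (hαβ : α * β ≤ d) :
    ∃ C : ℝ, 0 < C ∧
      ∀ (nQ : ℕ) (nP : Fin m → ℕ), 2 ≤ totalSize nQ nP →
      ∀ f : Data d nQ nP → Feature d → Bool, IsAdaptiveClassifier f →
      ∀ (P : Fin m → Measure (Feature d × Bool)) (Q : Measure (Feature d × Bool))
        (ηP : Fin m → Feature d → ℝ) (ηQ : Feature d → ℝ),
        MemClass α Cα β Cβ γ Cγ μlo μhi cμ rμ P Q ηP ηQ →
        Integrable (fun Z => excessRisk Q ηQ (f Z)) (dataLaw P Q nQ nP) ∧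
        ∫ Z, excessRisk Q ηQ (f Z) ∂(dataLaw P Q nQ nP) ≤
          C * ((nQ : ℝ) / Real.log (totalSize nQ nP) +
              ∑ i, ((nP i : ℝ) / Real.log (totalSize nQ nP)) ^
                ((2 * β + d) / (2 * γ i * β + d))) ^
            (-(β * (1 + α) / (2 * β + d))) := by
  obtain ⟨A, hA, hmain⟩ := exists_measure_ne_bayes_le (α := α) (Cα := Cα) (μhi := μhi)
    hd hm hβ hCβ hγ hCγ hμlo hcμ hrμ
  set K := (expMomentBound ^ (m + 1) + 1).toReal with hK
  have hKtop : expMomentBound ^ (m + 1) + 1 ≠ ⊤ :=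
    ENNReal.add_ne_top.2 ⟨ENNReal.pow_ne_top expMomentBound_ne_top, ENNReal.one_ne_top⟩
  have hK0 : 0 ≤ K := ENNReal.toReal_nonneg
  set θ := β * (1 + α) / (2 * β + d) with hθ
  -- The first term comes from the margin region `Δ < A δ`, the second from the failure probability
  -- outside it.
  refine ⟨2 * Cα * A ^ (1 + α) + K * (4 * ((m : ℝ) + 1) ^ θ), by positivity, ?_⟩
  intro nQ nP hn f hf P Q ηP ηQ hmem
  change _ ∧ _ ≤ _ * effSize β γ d nQ nP ^ (-θ)
  have := hmem.probP
  have := hmem.probQ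
  have hL : ∀ s : SampleIdx nQ nP, IsProbabilityMeasure (s.1.elim Q P) := by
    rintro ⟨_ | i, j⟩
    · exact inferInstanceAs (IsProbabilityMeasure Q)
    · exact inferInstanceAs (IsProbabilityMeasure (P i))
  have hlaw : IsProbabilityMeasure (dataLaw P Q nQ nP) := by
    unfold dataLaw; infer_instance
  have hS := effSize_pos hβ (γ := γ) (d := d) hn
  set δ := effSize β γ d nQ nP ^ (-(β / (2 * β + d))) with hδ
  have hδ0 : 0 < δ := by positivity
  obtain ⟨hint, hle⟩ := integral_excessRisk_le (μ := dataLaw P Q nQ nP) hmem.regQ hmem.margin hCα.le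
    hf.measurable (τ := A * δ) (ε := K * ((totalSize nQ nP : ℝ) ^ 2)⁻¹) (by positivity)
    (by positivity) (fun x hx hxτ => by
      have h1 := ENNReal.toReal_mono (ENNReal.mul_ne_top hKtop ENNReal.ofReal_ne_top)
        (hmain nQ nP hn f hf P Q ηP ηQ hmem x hx hxτ)
      rwa [ENNReal.toReal_mul, ENNReal.toReal_ofReal (by positivity)] at h1)
  refine ⟨hint, hle.trans ?_⟩
  have h1 : 2 * (A * δ) * (Cα * (A * δ) ^ α) =
      2 * Cα * A ^ (1 + α) * effSize β γ d nQ nP ^ (-θ) := by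
    have h2 : δ ^ (1 + α) = effSize β γ d nQ nP ^ (-θ) := by
      rw [hδ, ← Real.rpow_mul hS.le, hθ]; congr 1; ring
    rw [← h2, Real.rpow_add hA, Real.rpow_add hδ0, Real.rpow_one, Real.rpow_one,
      Real.mul_rpow hA.le hδ0.le]
    ring
  have h3 := mul_le_mul_of_nonneg_left
    (inv_sq_le_effSize_rpow (γ := γ) hd hα hβ hβ1 hγ hαβ hn) hK0
  rw [h1, add_mul]
  refine add_le_add le_rfl (h3.trans (le_of_eq ?_))
  rw [hθ]; ring
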